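/- Let $n\ge 2$ and let $R\in\mathbb{R}^{n\times n}$ be a density matrix, i.e. a symmetric positive semidefinite matrix with unit trace, whose eigenvalues $p_1,\dots,p_n$ all satisfy $p_i\ge\ell$ for some $\ell>0$. Let $H(R)=-\sum_{i=1}^n p_i\ln p_i$ be its von Neumann entropy, $\mathrm{nnz}(R)$ its number of nonzero entries, $0<\epsilon<1$ and $0<\delta\le 1/2$. Consider the following algorithm. 1. (Power method) Let $q=\lceil 4.82\ln(1/\delta)\rceil$ and $t=\lceil\ln\sqrt{4n}\rceil$. For $j=1,\dots,q$ draw $x_0^j$ uniformly at random from $\{\pm1\}^n$, independently, let $x^j=R^t x_0^j$, and let $\tilde p_1=\max_{1\le j\le q}\frac{(x^j)^\top R x^j}{(x^j)^\top x^j}$. Set $u=\min\{1,6\tilde p_1\}$. 2. Set $m=\left\lceil\sqrt{\frac{u}{2\epsilon\ell\ln(1/(1-\ell))}}\right\rceil$ and $s=\lceil 20\ln(2/\delta)/\epsilon^2\rceil$. 3. Let $g_1,\dots,g_s\in\mathbb{R}^n$ be i.i.d. standard Gaussian vectors, independent of the sign vectors in step 1, and return $$\widehat H(R)=-\frac1s\sum_{i=1}^s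 g_i^\top f_m(R)\,g_i,\qquad f_m(x)=\sum_{w=0}^m\alpha_w T_w\!\left(\tfrac{2}{u}x-1\right),$$ where $T_w$ is the $w$-th Chebyshev polynomial of the first kind, $\alpha_0=\frac u2\left(\ln\frac u4+1\right)$, $\alpha_1=\frac u4\left(2\ln\frac u4+3\right)$ and $\alpha_w=\frac{(-1)^w u}{w^3-w}$ for $w\ge2$. Each $g_i^\top f_m(R)g_i$ is evaluated by Clenshaw's algorithm: $y_{m+2}=y_{m+1}=0$, $y_k=\alpha_k g_i+\frac4u R y_{k+1}-2y_{k+1}-y_{k+2}$ for $k=m,\dots,0$, and $g_i^\top f_m(R)g_i=\frac12\left(\alpha_0\,g_i^\top g_i+g_i^\top(y_0-y_2)\right)$. Then, with probability at least $1-2\delta$, $$\left|\widehat H(R)-H(R)\right|\le 3\epsilon\,H(R).$$ Moreover, with $R$ given in sparse row format, the algorithm computes $\widehat H(R)$, for every outcome of its random choices, in $$\mathcal{O}\left(\left(\sqrt{\frac{u}{\ell\ln(1/(1-\ell))}}\cdot\frac1{\epsilon^{2.5}}+\ln n\right)\ln(1/\delta)\cdot\mathrm{nnz}(R)\right)$$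 steps, where the constant is absolute and one step is one scalar operation (arithmetic, comparison, logarithm, square root, rounding), one random draw of a sign or of a standard Gaussian, one store or one loop iteration. -/

import Mathlib

open MeasureTheory ProbabilityTheory
open scoped Matrix

noncomputable section

namespace EntropyEstimation

/-! ### Density matrices and the von Neumann entropy -/

/-- A (real) density matrix: symmetric positive semidefinite with unit trace. -/
structure IsDensityMatrix {n : ℕ} (R : Matrix (Fin n) (Fin n) ℝ) : Prop where
  posSemidef : R.PosSemidef
  trace_eq_one : R.trace = 1

/-- `H(R) = -∑ pᵢ ln pᵢ` over the eigenvalues `pᵢ` of `R` (with `0 ln 0 = 0`). -/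
def vonNeumannEntropy {n : ℕ} {R : Matrix (Fin n) (Fin n) ℝ} (hR : R.IsHermitian) : ℝ :=
  -∑ i, hR.eigenvalues i * Real.log (hR.eigenvalues i)

/-- The number of nonzero entries of a matrix. -/
def nnz {n : ℕ} (R : Matrix (Fin n) (Fin n) ℝ) : ℕ :=
  (Finset.univ.filter fun p : Fin n × Fin n => R p.1 p.2 ≠ 0).card

/-! ### The Chebyshev approximant of `x ln x` on `[0, u]` -/

/-- The coefficients `α_w`. -/
def chebCoeff (u : ℝ) : ℕ → ℝ
  | 0 => u / 2 * (Real.log (u / 4) + 1)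
  | 1 => u / 4 * (2 * Real.log (u / 4) + 3)
  | w + 2 => (-1) ^ (w + 2) * u / (((w + 2 : ℕ) : ℝ) ^ 3 - ((w + 2 : ℕ) : ℝ))

/-- `f_m(x) = ∑_{w ≤ m} α_w T_w((2/u) x - 1)`, with `T_w` the Chebyshev polynomial of the first
kind, for which `T_w(cos θ) = cos (w θ)`. -/
def chebApprox (u : ℝ) (m : ℕ) : Polynomial ℝ :=
  ∑ w ∈ Finset.range (m + 1),
    Polynomial.C (chebCoeff u w) *
      (Polynomial.Chebyshev.T ℝ (w : ℤ)).comp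
        (Polynomial.C (2 / u) * Polynomial.X - 1)

/-! ### Parameters of the algorithm -/

/-- `q`, the number of repetitions of the power method. -/
def powerReps (δ : ℝ) : ℕ := ⌈4.82 * Real.log (1 / δ)⌉₊

/-- `t`, the number of iterations in each repetition of the power method. -/
def powerIters (n : ℕ) : ℕ := ⌈Real.log (Real.sqrt (4 * n))⌉₊

/-- `s`, the number of Gaussian vectors. -/
def numSamples (ε δ : ℝ) : ℕ := ⌈20 * Real.log (2 / δ) / ε ^ 2⌉₊

/-- `m`, the degree of the Chebyshev approximant, chosen once `u` is known. -/
def chebDegree (ℓ ε u : ℝ) : ℕ :=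
  ⌈Real.sqrt (u / (2 * ε * ℓ * Real.log (1 / (1 - ℓ))))⌉₊

/-! ### The randomness -/

/-- The random source: fair coins `(j, i)` (entry `i` of the random sign vector of repetition `j`
of the power method) and reals `(k, i)` (entry `i` of the `k`-th Gaussian vector). -/
abbrev Tape (n : ℕ) : Type := (ℕ × Fin n → Bool) × (ℕ × Fin n → ℝ)

/-- The coins are fair, the reals are standard Gaussian, and all of them are independent. -/
def tapeMeasure (n : ℕ) : Measure (Tape n) :=
  (Measure.infinitePi fun _ : ℕ × Fin n => (PMF.uniformOfFintype Bool).toMeasure).prod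
    (Measure.infinitePi fun _ : ℕ × Fin n => gaussianReal 0 1)

/-- A coin read as a sign. -/
def signOf (b : Bool) : ℝ := if b then 1 else -1

/-- The initial sign vector of repetition `j` of the power method. -/
def signVec {n : ℕ} (ω : Tape n) (j : ℕ) : Fin n → ℝ := fun i => signOf (ω.1 (j, i))

/-- The `k`-th Gaussian vector. -/
def gaussVec {n : ℕ} (ω : Tape n) (k : ℕ) : Fin n → ℝ := fun i => ω.2 (k, i)

/-! ### What the algorithm outputs -/

/-- `xᵀ A x / xᵀ x`. -/
def rayleigh {n : ℕ} (A : Matrix (Fin n) (Fin n) ℝ) (x : Fin n → ℝ) : ℝ :=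
  (x ⬝ᵥ (A *ᵥ x)) / (x ⬝ᵥ x)

/-- The power method with `q` repetitions of `t` iterations: the largest of the Rayleigh
quotients of `Aᵗ x₀ʲ`, `j < q`. -/
def powerEstimate {n : ℕ} (A : Matrix (Fin n) (Fin n) ℝ) (q t : ℕ) (ω : Tape n) : ℝ :=
  ⨆ j : Fin q, rayleigh A ((A ^ t) *ᵥ signVec ω j)

/-- `u = min {1, 6 p̃₁}`. -/
def upperEstimate {n : ℕ} (R : Matrix (Fin n) (Fin n) ℝ) (δ : ℝ) (ω : Tape n) : ℝ :=
  min 1 (6 * powerEstimate R (powerReps δ) (powerIters n) ω)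

/-- `-(1/s) ∑_{k < s} gₖᵀ f_m(R) gₖ`. -/
def traceEstimate {n : ℕ} (R : Matrix (Fin n) (Fin n) ℝ) (u : ℝ) (m s : ℕ) (ω : Tape n) : ℝ :=
  -(1 / (s : ℝ) * ∑ k ∈ Finset.range s,
      gaussVec ω k ⬝ᵥ (Polynomial.aeval R (chebApprox u m) *ᵥ gaussVec ω k))

/-- The output: the trace estimate with `u`, `m`, `s` as above. -/
def entropyEstimate {n : ℕ} (R : Matrix (Fin n) (Fin n) ℝ) (ℓ ε δ : ℝ) (ω : Tape n) : ℝ :=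
  traceEstimate R (upperEstimate R δ ω) (chebDegree ℓ ε (upperEstimate R δ ω))
    (numSamples ε δ) ω

/-! ### Computations with a step count

The cost model is the real-number random access machine. Every arithmetic operation or elementary
function evaluation on scalars, every random draw, every store of a vector entry and every loop
iteration is one step. -/

/-- A value together with the number of steps spent on computing it. -/
structure Timed (α : Type) where
  val : α
  steps : ℕ

namespace Timed

instance : Monad Timed where
  pure a := ⟨a, 0⟩
  bind x f := ⟨(f x.val).val, x.steps + (f x.val).steps⟩

/-- A single step with the given result. It is used only for the instructions listed next. -/
def instr {α : Type} (a : α) : Timed α := ⟨a, 1⟩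

def radd (x y : ℝ) : Timed ℝ := instr (x + y)
def rsub (x y : ℝ) : Timed ℝ := instr (x - y)
def rmul (x y : ℝ) : Timed ℝ := instr (x * y)
def rdiv (x y : ℝ) : Timed ℝ := instr (x / y)
def rneg (x : ℝ) : Timed ℝ := instr (-x)
def rmax (x y : ℝ) : Timed ℝ := instr (max x y)
def rmin (x y : ℝ) : Timed ℝ := instr (min x y)
def rlog (x : ℝ) : Timed ℝ := instr (Real.log x)
def rsqrt (x : ℝ) : Timed ℝ := instr (Real.sqrt x)
def rceil (x : ℝ) : Timed ℕ := instr ⌈x⌉₊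
def castReal (k : ℕ) : Timed ℝ := instr (k : ℝ)
def testEven (k : ℕ) : Timed Bool := instr (decide (k % 2 = 0))
/-- Draw the random sign number `i` of vector `j`. -/
def drawSign {n : ℕ} (ω : Tape n) (j : ℕ) (i : Fin n) : Timed ℝ := instr (signOf (ω.1 (j, i)))
/-- Draw the standard Gaussian number `i` of vector `k`. -/
def drawGauss {n : ℕ} (ω : Tape n) (k : ℕ) (i : Fin n) : Timed ℝ := instr (ω.2 (k, i))
/-- One step of loop bookkeeping. -/
def tick : Timed Unit := instr ()

/-- Compute and store the `n` entries of a vector, each store being one step. -/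
def tabulate {n : ℕ} (f : Fin n → Timed ℝ) : Timed (Fin n → ℝ) :=
  ⟨fun i => (f i).val, ∑ i, ((f i).steps + 1)⟩

/-- Run the body for `k = N - 1, N - 2, …, 0`. -/
def loop {β : Type} (body : ℕ → β → Timed β) : ℕ → β → Timed β
  | 0, b => pure b
  | k + 1, b => do
    tick
    let b' ← body k b
    loop body k b'

/-- Run the body for all elements of a list. -/
def forList {γ β : Type} (body : γ → β → Timed β) : List γ → β → Timed β
  | [], b => pure b
  | x :: xs, b => do
    tick
    let b' ← body x b
    forList body xs b'

end Timed

open Timed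

/-- Sparse row representation: for each row the list of its nonzero entries with their columns. -/
abbrev SparseRows (n : ℕ) : Type := Fin n → List (Fin n × ℝ)

/-- The sparse row representation of a matrix, which is the input format of the algorithm. -/
def sparseRows {n : ℕ} (R : Matrix (Fin n) (Fin n) ℝ) : SparseRows n := fun i =>
  ((List.finRange n).filter fun j => decide (R i j ≠ 0)).map fun j => (j, R i j)

/-- Inner product of two vectors. -/
def dotProg {n : ℕ} (v w : Fin n → ℝ) : Timed ℝ :=
  forList (fun i acc => do
    let p ← rmul (v i) (w i)
    radd acc p) (List.finRange n) 0

/-- Sparse matrix times vector. -/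
def matVecProg {n : ℕ} (rows : SparseRows n) (v : Fin n → ℝ) : Timed (Fin n → ℝ) :=
  tabulate fun i =>
    forList (fun e acc => do
      let p ← rmul e.2 (v e.1)
      radd acc p) (rows i) 0

/-- Power method with `q` repetitions of `t` iterations. The running maximum starts at `0`; the
quotients are positive for a positive definite matrix. -/
def powerProg {n : ℕ} (rows : SparseRows n) (q t : ℕ) (ω : Tape n) : Timed ℝ :=
  loop (fun j best => do
    let x₀ ← tabulate fun i => drawSign ω j i
    let x ← loop (fun _ x => matVecProg rows x) t x₀
    let y ← matVecProg rows x
    let num ← dotProg x y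
    let den ← dotProg x x
    let r ← rdiv num den
    rmax best r) q 0

/-- The coefficient `α_w`. -/
def coeffProg (u : ℝ) : ℕ → Timed ℝ
  | 0 => do
    let a ← rdiv u 4
    let b ← rlog a
    let c ← radd b 1
    let d ← rdiv u 2
    rmul d c
  | 1 => do
    let a ← rdiv u 4
    let b ← rlog a
    let c ← rmul 2 b
    let d ← radd c 3
    rmul a d
  | w + 2 => do
    let x ← castReal (w + 2)
    let x₂ ← rmul x x
    let x₃ ← rmul x₂ x
    let d ← rsub x₃ x
    let r ← rdiv u d
    let even ← testEven (w + 2)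
    if even then pure r else rneg r

/-- Clenshaw's algorithm for `gᵀ f_m(R) g`. The state holds `(y_{k+1}, y_{k+2}, y_{k+3})` before
the iteration with index `k`, for `k = m, m - 1, …, 0`. -/
def clenshawProg {n : ℕ} (rows : SparseRows n) (u : ℝ) (m : ℕ) (g : Fin n → ℝ) : Timed ℝ := do
  let zero ← tabulate fun _ => pure 0
  let y ← loop (fun k (y : (Fin n → ℝ) × (Fin n → ℝ) × (Fin n → ℝ)) => do
    let a ← coeffProg u k
    let c ← rdiv 4 u
    let z ← matVecProg rows y.1
    let y' ← tabulate fun i => do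
      let a₁ ← rmul a (g i)
      let a₂ ← rmul c (z i)
      let a₃ ← rmul 2 (y.1 i)
      let b₁ ← radd a₁ a₂
      let b₂ ← rsub b₁ a₃
      rsub b₂ (y.2.1 i)
    pure (y', y.1, y.2.1)) (m + 1) (zero, zero, zero)
  let gg ← dotProg g g
  let a₀ ← coeffProg u 0
  let d ← tabulate fun i => rsub (y.1 i) (y.2.2 i)
  let gd ← dotProg g d
  let r₁ ← rmul a₀ gg
  let r₂ ← radd r₁ gd
  rdiv r₂ 2

def powerRepsProg (δ : ℝ) : Timed ℕ := do
  let a ← rdiv 1 δ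
  let b ← rlog a
  let c ← rmul 4.82 b
  rceil c

def powerItersProg (n : ℕ) : Timed ℕ := do
  let x ← castReal n
  let a ← rmul 4 x
  let b ← rsqrt a
  let c ← rlog b
  rceil c

def numSamplesProg (ε δ : ℝ) : Timed ℕ := do
  let a ← rdiv 2 δ
  let b ← rlog a
  let c ← rmul 20 b
  let d ← rmul ε ε
  let e ← rdiv c d
  rceil e

def chebDegreeProg (ℓ ε u : ℝ) : Timed ℕ := do
  let a ← rsub 1 ℓ
  let b ← rdiv 1 a
  let c ← rlog b
  let d ← rmul 2 ε
  let e ← rmul d ℓ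
  let f ← rmul e c
  let g ← rdiv u f
  let h ← rsqrt g
  rceil h

/-- The whole algorithm: power method, choice of `u`, `m` and `s`, and the Gaussian trace
estimator in which each `gᵀ f_m(R) g` is evaluated by Clenshaw's algorithm. -/
def entropyProg {n : ℕ} (rows : SparseRows n) (ℓ ε δ : ℝ) (ω : Tape n) : Timed ℝ := do
  let q ← powerRepsProg δ
  let t ← powerItersProg n
  let p ← powerProg rows q t ω
  let p₆ ← rmul 6 p
  let u ← rmin 1 p₆
  let m ← chebDegreeProg ℓ ε u
  let s ← numSamplesProg ε δ
  let total ← loop (fun k acc => do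
    let g ← tabulate fun i => drawGauss ω k i
    let v ← clenshawProg rows u m g
    radd acc v) s 0
  let sR ← castReal s
  let avg ← rdiv total sR
  rneg avg

end EntropyEstimation

end

open MeasureTheory ProbabilityTheory
open scoped Matrix

noncomputable section

namespace EntropyEstimation

section

/-! ### Values and step counts of the elementary programs -/

namespace Timed

variable {α β γ : Type}

/-! Accuracy rests on a scalar estimate, two concentration bounds and a union bound. For `z = exp
(iθ)` with `cos θ = 2x/u - 1`, one has `(1+z)²/z = |1+z|² = 4x/u`, so the real part of `(1+z)²/z ·
log (1+z)` is `(4x/u) · ½ ln (4x/u)`. Expanding the logarithm writes `x ln x` as the cosine series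
with coefficients `α_w`. These decay like `u/w³` and their tails telescope, so degree `m` leaves an
error of at most `u/(2m(m+1))` on `(0, u]` (`abs_chebApprox_sub_le`). Each eigenvalue lies in `[ℓ,
1-ℓ]` and contributes at least `ℓ ln (1/(1-ℓ))` to the entropy (`le_neg_mul_log`), so the choice of
`m` makes this error at most `ε` times that contribution. In particular `-f_m` is positive on the
spectrum and `-tr f_m(R)` is within `εH(R)` of `H(R)`.

For fixed `u`, rotation invariance turns each `-gᵀ f_m(R) g` into a nonnegative combination of
independent squared Gaussians. A Chernoff bound over the `s` samples gives relative error `ε` except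
with probability `δ` (`measureReal_gaussian_quadratic_le`).

The scalar estimate needs `u` to dominate the spectrum. A random sign vector has squared inner
product at least `1/4` with a given unit vector with probability at least `3/16`, by its second and
fourth moments. A start so correlated with a top eigenvector yields a Rayleigh quotient of at least
`p₁/6` after `t` iterations (`eigenvalue_le_six_mul_rayleigh`). All `q` starts fail with probability
at most `(13/16)^q ≤ δ`. As `u` depends only on finitely many signs, it takes finitely many values,
and the Gaussian bound can be applied conditionally on each (`measure_prod_le_of_forall_slice`).

The program computes the estimate because the Clenshaw vectors are `∑ α_j U_{j-k}(X) g` and `2 T_j =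
U_j - U_{j-2}`. Its cost is counted loop by loop. Positive definiteness gives `n ≤ nnz R`, so all
work on vectors is absorbed into `nnz R`. -/

@[simp] theorem val_pure (a : α) : (pure a : Timed α).val = a := rfl

@[simp] theorem steps_pure (a : α) : (pure a : Timed α).steps = 0 := rfl

@[simp] theorem val_bind (x : Timed α) (f : α → Timed β) : (x >>= f).val = (f x.val).val := rfl

@[simp] theorem steps_bind (x : Timed α) (f : α → Timed β) :
    (x >>= f).steps = x.steps + (f x.val).steps := rfl

@[simp] theorem val_instr (a : α) : (instr a).val = a := rfl

@[simp] theorem steps_instr (a : α) : (instr a).steps = 1 := rfl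

@[simp] theorem val_tabulate {n : ℕ} (f : Fin n → Timed ℝ) :
    (tabulate f).val = fun i => (f i).val := rfl

theorem steps_tabulate_of_const {n : ℕ} {f : Fin n → Timed ℝ} {K : ℕ}
    (h : ∀ i, (f i).steps = K) : (tabulate f).steps = n * (K + 1) := by
  simp [tabulate, h]

@[simp] theorem loop_zero (body : ℕ → β → Timed β) (b : β) : loop body 0 b = pure b := rfl

theorem val_loop_succ (body : ℕ → β → Timed β) (k : ℕ) (b : β) :
    (loop body (k + 1) b).val = (loop body k (body k b).val).val := rfl

theorem steps_loop_succ (body : ℕ → β → Timed β) (k : ℕ) (b : β) :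
    (loop body (k + 1) b).steps
      = 1 + ((body k b).steps + (loop body k (body k b).val).steps) := rfl

/-- Induction with an invariant for the value of a loop. -/
theorem loop_invariant (body : ℕ → β → Timed β) (P : ℕ → β → Prop)
    (N : ℕ) (step : ∀ k < N, ∀ b, P (k + 1) b → P k (body k b).val) (b : β) (h : P N b) :
    P 0 (loop body N b).val := by
  induction N generalizing b with
  | zero => exact h
  | succ N ih =>
    rw [val_loop_succ]
    exact ih (fun k hk => step k (hk.trans N.lt_succ_self)) _ (step N N.lt_succ_self b h)

theorem steps_loop_le (body : ℕ → β → Timed β) {K : ℕ} (h : ∀ k b, (body k b).steps ≤ K) :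
    ∀ (N : ℕ) (b : β), (loop body N b).steps ≤ N * (K + 1)
  | 0, _ => by simp
  | N + 1, b => by
    have h₁ := steps_loop_le body h N (body N b).val
    have h₂ := h N b
    rw [steps_loop_succ]
    linarith

/-- A loop accumulating a sum. -/
theorem val_loop_sum (body : ℕ → ℝ → Timed ℝ) (f : ℕ → ℝ)
    (h : ∀ k b, (body k b).val = b + f k) :
    ∀ (N : ℕ) (b : ℝ), (loop body N b).val = b + ∑ k ∈ Finset.range N, f k
  | 0, b => by simp
  | N + 1, b => by
    rw [val_loop_succ, val_loop_sum body f h N, h, Finset.sum_range_succ]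
    ring

/-- Iterating a map by a loop. -/
theorem val_loop_iterate (body : ℕ → β → Timed β) (f : β → β)
    (h : ∀ k b, (body k b).val = f b) :
    ∀ (N : ℕ) (b : β), (loop body N b).val = f^[N] b
  | 0, b => rfl
  | N + 1, b => by
    rw [val_loop_succ, val_loop_iterate body f h N, h, Function.iterate_succ_apply]

/-- A loop computing a running maximum. -/
theorem val_loop_max (body : ℕ → ℝ → Timed ℝ) (f : ℕ → ℝ)
    (h : ∀ k b, (body k b).val = max b (f k)) :
    ∀ (N : ℕ) (b c : ℝ), (loop body N b).val ≤ c ↔ b ≤ c ∧ ∀ k < N, f k ≤ c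
  | 0, b, c => by simp
  | N + 1, b, c => by
    rw [val_loop_succ, val_loop_max body f h N, h, max_le_iff, Nat.forall_lt_succ_right]
    tauto

theorem val_forList_sum (body : γ → ℝ → Timed ℝ) (f : γ → ℝ)
    (h : ∀ x b, (body x b).val = b + f x) :
    ∀ (l : List γ) (b : ℝ), (forList body l b).val = b + (l.map f).sum
  | [], b => by simp [forList]
  | x :: l, b => by
    have : (forList body (x :: l) b).val = (forList body l (body x b).val).val := rfl
    rw [this, val_forList_sum body f h l, h, List.map_cons, List.sum_cons, add_assoc]

theorem steps_forList (body : γ → β → Timed β) {K : ℕ} (h : ∀ x b, (body x b).steps = K) :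
    ∀ (l : List γ) (b : β), (forList body l b).steps = l.length * (K + 1)
  | [], b => by simp [forList]
  | x :: l, b => by
    have : (forList body (x :: l) b).steps
        = 1 + ((body x b).steps + (forList body l (body x b).val).steps) := rfl
    rw [this, steps_forList body h l, h, List.length_cons]
    ring

end Timed

open Timed

/-! ### Inner products and sparse matrix-vector products -/

variable {n : ℕ}

theorem val_dotProg (v w : Fin n → ℝ) : (dotProg v w).val = v ⬝ᵥ w := by
  rw [dotProg, val_forList_sum _ (fun i => v i * w i) (fun _ _ => rfl), zero_add,
    ← Fin.sum_univ_def]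
  rfl

theorem steps_dotProg (v w : Fin n → ℝ) : (dotProg v w).steps = n * 3 := by
  rw [dotProg, steps_forList (K := 2) _ (fun _ _ => rfl), List.length_finRange]

theorem sum_sparseRows (R : Matrix (Fin n) (Fin n) ℝ) (v : Fin n → ℝ) (i : Fin n) :
    ((sparseRows R i).map fun e => e.2 * v e.1).sum = (R *ᵥ v) i := by
  have h : ∀ l : List (Fin n),
      (((l.filter fun j => decide (R i j ≠ 0)).map fun j => (j, R i j)).map
        fun e : Fin n × ℝ => e.2 * v e.1).sum = (l.map fun j => R i j * v j).sum := by
    intro l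
    induction l with
    | nil => simp
    | cons j l ih =>
      by_cases hj : R i j = 0
      · simpa [hj] using ih
      · simpa [hj] using ih
  rw [sparseRows, h, ← Fin.sum_univ_def]
  rfl

theorem val_matVecProg (R : Matrix (Fin n) (Fin n) ℝ) (v : Fin n → ℝ) :
    (matVecProg (sparseRows R) v).val = R *ᵥ v := by
  funext i
  rw [← sum_sparseRows, matVecProg, val_tabulate]
  dsimp only
  rw [val_forList_sum _ (fun e : Fin n × ℝ => e.2 * v e.1) (fun _ _ => rfl), zero_add]

theorem sum_length_sparseRows (R : Matrix (Fin n) (Fin n) ℝ) :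
    ∑ i, (sparseRows R i).length = nnz R := by
  have h : ∀ i, (sparseRows R i).length = (Finset.univ.filter fun j => R i j ≠ 0).card := by
    intro i
    rw [sparseRows, List.length_map, ← List.toFinset_card_of_nodup
      ((List.nodup_finRange n).filter _)]
    congr 1
    ext j
    simp
  simp_rw [h, nnz, Finset.card_filter]
  rw [← Finset.univ_product_univ, Finset.sum_product]

theorem steps_matVecProg (R : Matrix (Fin n) (Fin n) ℝ) (v : Fin n → ℝ) :
    (matVecProg (sparseRows R) v).steps = 3 * nnz R + n := by
  have h : ∀ i, (forList (fun (e : Fin n × ℝ) acc => do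
      let p ← rmul e.2 (v e.1)
      radd acc p) (sparseRows R i) 0).steps = (sparseRows R i).length * 3 := fun i =>
    steps_forList (K := 2) _ (fun _ _ => rfl) _ _
  simp only [matVecProg, tabulate, h]
  rw [Finset.sum_add_distrib, ← Finset.sum_mul, sum_length_sparseRows]
  simp [mul_comm]

/-! ### The power method program -/

theorem iterate_mulVec (A : Matrix (Fin n) (Fin n) ℝ) (t : ℕ) (x : Fin n → ℝ) :
    (fun y => A *ᵥ y)^[t] x = (A ^ t) *ᵥ x := by
  induction t generalizing x with
  | zero => simp
  | succ t ih => rw [Function.iterate_succ_apply, ih, Matrix.mulVec_mulVec, pow_succ]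

theorem val_powerProg (R : Matrix (Fin n) (Fin n) ℝ) (hR : ∀ x, 0 ≤ rayleigh R x) (q t : ℕ)
    (ω : Tape n) : (powerProg (sparseRows R) q t ω).val = powerEstimate R q t ω := by
  have key := val_loop_max (fun j best => do
    let x₀ ← tabulate fun i => drawSign ω j i
    let x ← loop (fun _ x => matVecProg (sparseRows R) x) t x₀
    let y ← matVecProg (sparseRows R) x
    let num ← dotProg x y
    let den ← dotProg x x
    let r ← rdiv num den
    rmax best r) (fun j => rayleigh R ((R ^ t) *ᵥ signVec ω j)) (by
      intro k b
      simp only [val_bind, val_dotProg, val_matVecProg, val_tabulate, rdiv, rmax, val_instr,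
        drawSign,
        val_loop_iterate (fun _ x => matVecProg (sparseRows R) x) (fun x => R *ᵥ x)
          (fun _ b => val_matVecProg R b), iterate_mulVec]
      rfl) q 0
  have bdd : BddAbove (Set.range fun j : Fin q => rayleigh R ((R ^ t) *ᵥ signVec ω j)) :=
    Set.Finite.bddAbove (Set.finite_range _)
  -- The loop starts its maximum at `0`, and a supremum over an empty `Fin q` is `0`. Nonnegativity
  -- of the quotients makes the two agree for every `q`.
  refine le_antisymm ?_ ?_
  · refine (key _).2 ⟨Real.iSup_nonneg fun _ => hR _, fun k hk => ?_⟩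
    exact le_ciSup bdd (⟨k, hk⟩ : Fin q)
  · obtain ⟨h₀, h₁⟩ := (key _).1 le_rfl
    exact Real.iSup_le (fun j => h₁ j j.2) h₀

theorem steps_powerProg_le (R : Matrix (Fin n) (Fin n) ℝ) (hn : n ≤ nnz R) (hn₁ : 1 ≤ n)
    (q t : ℕ) (ω : Tape n) :
    (powerProg (sparseRows R) q t ω).steps ≤ q * ((15 + 5 * t) * nnz R) := by
  refine (steps_loop_le _ (K := (14 + 5 * t) * nnz R) ?_ q 0).trans ?_
  · intro k b
    have h₁ := fun x => steps_loop_le (fun _ x => matVecProg (sparseRows R) x)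
      (K := 3 * nnz R + n) (fun _ x => (steps_matVecProg R x).le) t x
    have h₂ : (tabulate fun i => drawSign ω k i).steps = n * 2 :=
      steps_tabulate_of_const fun _ => rfl
    -- Here and below, `1 ≤ n ≤ nnz R` turns every additive `n` or `1` into a multiple of `nnz R`.
    have h₃ : t * (3 * nnz R + n + 1) ≤ t * (5 * nnz R) := Nat.mul_le_mul_left _ (by omega)
    simp only [steps_bind, steps_dotProg, steps_matVecProg, rdiv, rmax, steps_instr]
    have h₄ := h₁ (tabulate fun i => drawSign ω k i).val
    rw [h₂]
    nlinarith
  · exact Nat.mul_le_mul_left _ (by nlinarith)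

/-! ### Clenshaw's algorithm -/

theorem val_coeffProg (u : ℝ) (w : ℕ) : (coeffProg u w).val = chebCoeff u w := by
  match w with
  | 0 => rfl
  | 1 => rfl
  | w + 2 =>
    have h : (coeffProg u (w + 2)).val
        = if (w + 2) % 2 = 0 then u / ((((w + 2 : ℕ) : ℝ) * ((w + 2 : ℕ) : ℝ)) *
            ((w + 2 : ℕ) : ℝ) - ((w + 2 : ℕ) : ℝ))
          else -(u / ((((w + 2 : ℕ) : ℝ) * ((w + 2 : ℕ) : ℝ)) *
            ((w + 2 : ℕ) : ℝ) - ((w + 2 : ℕ) : ℝ))) := by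
      by_cases hw : (w + 2) % 2 = 0
      · simp only [coeffProg, val_bind, castReal, rmul, rsub, rdiv, testEven, val_instr, hw,
          decide_true, if_true, val_pure]
      · simp only [coeffProg, val_bind, castReal, rmul, rsub, rdiv, testEven, val_instr, hw,
          decide_false, if_false, rneg, Bool.false_eq_true]
    have hx : ((w + 2 : ℕ) : ℝ) ^ 3 = (((w + 2 : ℕ) : ℝ) * ((w + 2 : ℕ) : ℝ)) *
        ((w + 2 : ℕ) : ℝ) := by ring
    rw [h, chebCoeff, hx]
    split_ifs with hw
    · rw [(Nat.even_iff.2 hw).neg_one_pow, one_mul]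
    · rw [(Nat.not_even_iff_odd.1 (mt Nat.even_iff.1 hw)).neg_one_pow, neg_one_mul, neg_div]

theorem steps_coeffProg_le (u : ℝ) (w : ℕ) : (coeffProg u w).steps ≤ 7 := by
  match w with
  | 0 => simp [coeffProg, rdiv, rlog, radd, rmul]
  | 1 => simp [coeffProg, rdiv, rlog, radd, rmul]
  | w + 2 =>
    by_cases hw : (w + 2) % 2 = 0
    · simp only [coeffProg, steps_bind, castReal, rmul, rsub, rdiv, testEven, val_instr,
        steps_instr, hw, decide_true, if_true, steps_pure]
      norm_num
    · simp only [coeffProg, steps_bind, castReal, rmul, rsub, rdiv, testEven, val_instr,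
        steps_instr, hw, decide_false, if_false, rneg, Bool.false_eq_true]
      norm_num

/-- The Clenshaw vectors `y_k = ∑_{k ≤ j ≤ m} α_j U_{j-k}(X) g`. -/
def clenshawVec (X : Matrix (Fin n) (Fin n) ℝ) (a : ℕ → ℝ) (m : ℕ) (g : Fin n → ℝ) (k : ℕ) :
    Fin n → ℝ :=
  ∑ j ∈ Finset.Ico k (m + 1),
    a j • (Polynomial.aeval X (Polynomial.Chebyshev.U ℝ ((j : ℤ) - k)) *ᵥ g)

theorem clenshawVec_eq_zero (X : Matrix (Fin n) (Fin n) ℝ) (a : ℕ → ℝ) (m : ℕ) (g : Fin n → ℝ)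
    {k : ℕ} (hk : m + 1 ≤ k) : clenshawVec X a m g k = 0 := by
  rw [clenshawVec, Finset.Ico_eq_empty (by omega), Finset.sum_empty]

theorem aeval_U_mulVec_step (X : Matrix (Fin n) (Fin n) ℝ) (g : Fin n → ℝ) (d : ℤ) :
    Polynomial.aeval X (Polynomial.Chebyshev.U ℝ (d + 2)) *ᵥ g
      = (2 : ℝ) • (X *ᵥ (Polynomial.aeval X (Polynomial.Chebyshev.U ℝ (d + 1)) *ᵥ g))
        - Polynomial.aeval X (Polynomial.Chebyshev.U ℝ d) *ᵥ g := by
  rw [Polynomial.Chebyshev.U_add_two, map_sub, map_mul, map_mul, Polynomial.aeval_X, map_ofNat,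
    Matrix.sub_mulVec, mul_assoc, ofNat_smul_eq_nsmul, ← Matrix.mulVec_mulVec,
    ← Matrix.mulVec_mulVec]
  congr 1
  rw [show (2 : Matrix (Fin n) (Fin n) ℝ) = 1 + 1 by norm_num, Matrix.add_mulVec,
    Matrix.one_mulVec, two_nsmul]

/-- The recurrence `U_{d+2} = 2X U_{d+1} - U_d`, applied to each term with index `j > k`. The term
`j = k` is `α_k U_0 g = α_k g`. -/
theorem clenshawVec_step (X : Matrix (Fin n) (Fin n) ℝ) (a : ℕ → ℝ) (m : ℕ) (g : Fin n → ℝ)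
    {k : ℕ} (hk : k ≤ m) :
    clenshawVec X a m g k = a k • g + (2 : ℝ) • (X *ᵥ clenshawVec X a m g (k + 1))
      - clenshawVec X a m g (k + 2) := by
  -- The sum for `y_{k+2}` may start at `j = k + 1` instead of `k + 2`: the added term carries
  -- `U_{-1} = 0`.
  have h₂ : clenshawVec X a m g (k + 2) = ∑ j ∈ Finset.Ico (k + 1) (m + 1),
      a j • (Polynomial.aeval X (Polynomial.Chebyshev.U ℝ ((j : ℤ) - k - 2)) *ᵥ g) := by
    rcases hk.eq_or_lt with rfl | hlt
    · rw [clenshawVec_eq_zero _ _ _ _ (by omega), Finset.Ico_self, Finset.sum_empty]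
    · rw [Finset.sum_eq_sum_Ico_succ_bot (by omega), clenshawVec]
      simp only [Nat.cast_add, Nat.cast_one, Nat.cast_ofNat]
      rw [show (k : ℤ) + 1 - k - 2 = -1 by ring, Polynomial.Chebyshev.U_neg_one, map_zero,
        Matrix.zero_mulVec, smul_zero, zero_add]
      simp only [sub_sub]
  have h₁ : (2 : ℝ) • (X *ᵥ clenshawVec X a m g (k + 1)) = ∑ j ∈ Finset.Ico (k + 1) (m + 1),
      a j • ((2 : ℝ) •
        (X *ᵥ (Polynomial.aeval X (Polynomial.Chebyshev.U ℝ ((j : ℤ) - k - 1)) *ᵥ g))) := by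
    rw [clenshawVec, Matrix.mulVec_sum, Finset.smul_sum]
    refine Finset.sum_congr rfl fun j _ => ?_
    rw [Matrix.mulVec_smul, smul_comm, Nat.cast_add, Nat.cast_one, sub_sub]
  rw [h₁, h₂, add_sub_assoc, ← Finset.sum_sub_distrib, clenshawVec,
    Finset.sum_eq_sum_Ico_succ_bot (by omega), sub_self, Polynomial.Chebyshev.U_zero, map_one,
    Matrix.one_mulVec]
  congr 1
  refine Finset.sum_congr rfl fun j _ => ?_
  rw [← smul_sub]
  have h := aeval_U_mulVec_step X g ((j : ℤ) - k - 2)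
  rw [show (j : ℤ) - k - 2 + 2 = j - k by ring, show (j : ℤ) - k - 2 + 1 = j - k - 1 by ring] at h
  rw [h]

/-- For `j ≥ 1` this is `U_j - U_{j-2} = 2 T_j`. The index `j = 0` enters only through `y_0`, giving
a single `α_0 g`. The separate `α_0 g` supplies the missing half, whence the final formula of
Clenshaw's algorithm. -/
theorem clenshawVec_zero_sub_two (X : Matrix (Fin n) (Fin n) ℝ) (a : ℕ → ℝ) (m : ℕ)
    (g : Fin n → ℝ) :
    a 0 • g + (clenshawVec X a m g 0 - clenshawVec X a m g 2)
      = (2 : ℝ) • ∑ j ∈ Finset.range (m + 1),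
          a j • (Polynomial.aeval X (Polynomial.Chebyshev.T ℝ j) *ᵥ g) := by
  have h₂ : clenshawVec X a m g 2 = ∑ j ∈ Finset.Ico 1 (m + 1),
      a j • (Polynomial.aeval X (Polynomial.Chebyshev.U ℝ ((j : ℤ) - 2)) *ᵥ g) := by
    rcases Nat.eq_zero_or_pos m with rfl | hm
    · rw [clenshawVec_eq_zero _ _ _ _ (by omega), Finset.Ico_self, Finset.sum_empty]
    · rw [Finset.sum_eq_sum_Ico_succ_bot (by omega), clenshawVec]
      rw [show ((1 : ℕ) : ℤ) - 2 = -1 by norm_num, Polynomial.Chebyshev.U_neg_one, map_zero,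
        Matrix.zero_mulVec, smul_zero, zero_add]
      rfl
  rw [Finset.range_eq_Ico, Finset.sum_eq_sum_Ico_succ_bot (by omega), smul_add, clenshawVec,
    Finset.sum_eq_sum_Ico_succ_bot (by omega), h₂, add_sub_assoc, ← Finset.sum_sub_distrib,
    ← add_assoc, zero_add, Finset.smul_sum]
  congr 1
  · simp [two_smul]
  · refine Finset.sum_congr rfl fun j _ => ?_
    have h := Polynomial.Chebyshev.two_mul_T_eq_U_sub_U ℝ ((j : ℤ) - 2)
    rw [show (j : ℤ) - 2 + 2 = j by ring] at h
    rw [← smul_sub, ← Matrix.sub_mulVec, smul_comm, Nat.cast_zero, sub_zero, ← map_sub, ← h,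
      map_mul, map_ofNat, two_smul ℝ, two_mul, Matrix.add_mulVec]

theorem aeval_chebApprox_mulVec (R : Matrix (Fin n) (Fin n) ℝ) (u : ℝ) (m : ℕ) (g : Fin n → ℝ) :
    Polynomial.aeval R (chebApprox u m) *ᵥ g = ∑ j ∈ Finset.range (m + 1),
      chebCoeff u j •
        (Polynomial.aeval ((2 / u) • R - 1) (Polynomial.Chebyshev.T ℝ j) *ᵥ g) := by
  rw [chebApprox, map_sum, Matrix.sum_mulVec]
  refine Finset.sum_congr rfl fun j _ => ?_
  rw [map_mul, Polynomial.aeval_C, Polynomial.aeval_comp, map_sub, map_mul, Polynomial.aeval_C,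
    Polynomial.aeval_X, map_one, ← Algebra.smul_def, ← Algebra.smul_def, Matrix.smul_mulVec]

theorem val_clenshawProg (R : Matrix (Fin n) (Fin n) ℝ) (u : ℝ) (m : ℕ) (g : Fin n → ℝ) :
    (clenshawProg (sparseRows R) u m g).val
      = g ⬝ᵥ (Polynomial.aeval R (chebApprox u m) *ᵥ g) := by
  have key := loop_invariant (fun k (y : (Fin n → ℝ) × (Fin n → ℝ) × (Fin n → ℝ)) => do
    let a ← coeffProg u k
    let c ← rdiv 4 u
    let z ← matVecProg (sparseRows R) y.1
    let y' ← tabulate fun i => do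
      let a₁ ← rmul a (g i)
      let a₂ ← rmul c (z i)
      let a₃ ← rmul 2 (y.1 i)
      let b₁ ← radd a₁ a₂
      let b₂ ← rsub b₁ a₃
      rsub b₂ (y.2.1 i)
    pure (y', y.1, y.2.1))
    -- With `X = (2/u) R - 1`, the update term `(4/u) R y - 2 y` is `2 X y`, so one pass of the loop
    -- is `clenshawVec_step`.
    (fun k y => y = (clenshawVec ((2 / u) • R - 1) (chebCoeff u) m g k,
      clenshawVec ((2 / u) • R - 1) (chebCoeff u) m g (k + 1),
      clenshawVec ((2 / u) • R - 1) (chebCoeff u) m g (k + 2))) (m + 1)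
    (by
      rintro k hk y rfl
      simp only [val_bind, val_pure, Prod.mk.injEq, and_true]
      rw [clenshawVec_step _ _ _ _ (show k ≤ m by omega)]
      funext i
      simp only [val_tabulate, val_bind, rmul, radd, rsub, rdiv, val_instr, val_coeffProg,
        val_matVecProg, Matrix.sub_mulVec, Matrix.one_mulVec, Matrix.smul_mulVec, Pi.add_apply,
        Pi.sub_apply, Pi.smul_apply, smul_eq_mul]
      generalize clenshawVec ((2 / u) • R - 1) (chebCoeff u) m g (k + 1) = v
      ring)
    (0, 0, 0) (by simp [clenshawVec_eq_zero])
  have zero_eq : (tabulate fun _ : Fin n => (pure 0 : Timed ℝ)).val = 0 := rfl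
  rw [clenshawProg]
  simp only [rmul, radd, rsub, rdiv] at key
  simp only [val_bind, zero_eq, val_dotProg, val_coeffProg, rmul, radd, rsub, rdiv, val_instr,
    val_tabulate]
  rw [key, aeval_chebApprox_mulVec]
  have h := congrArg (fun v => g ⬝ᵥ v) (clenshawVec_zero_sub_two ((2 / u) • R - 1) (chebCoeff u) m g)
  simp only [dotProduct_add, dotProduct_smul, smul_eq_mul] at h
  rw [div_eq_iff two_ne_zero, mul_comm _ (2 : ℝ), ← h]
  rfl

theorem steps_clenshawProg_le (R : Matrix (Fin n) (Fin n) ℝ) (hn : n ≤ nnz R) (hn₁ : 1 ≤ n)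
    (u : ℝ) (m : ℕ) (g : Fin n → ℝ) :
    (clenshawProg (sparseRows R) u m g).steps ≤ (m + 1) * (39 * nnz R) := by
  have key := steps_loop_le (fun k (y : (Fin n → ℝ) × (Fin n → ℝ) × (Fin n → ℝ)) => do
    let a ← coeffProg u k
    let c ← rdiv 4 u
    let z ← matVecProg (sparseRows R) y.1
    let y' ← tabulate fun i => do
      let a₁ ← rmul a (g i)
      let a₂ ← rmul c (z i)
      let a₃ ← rmul 2 (y.1 i)
      let b₁ ← radd a₁ a₂
      let b₂ ← rsub b₁ a₃
      rsub b₂ (y.2.1 i)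
    -- `19` collects `7 + 1` for the coefficient and `4/u`, `3 nnz R + n` for the product, and six
    -- operations plus a store for each entry of the new vector.
    pure (y', y.1, y.2.1)) (K := 19 * nnz R) (by
      intro k y
      simp only [steps_bind, steps_pure, steps_matVecProg, rdiv, steps_instr]
      rw [steps_tabulate_of_const (K := 6) (fun _ => rfl)]
      have := steps_coeffProg_le u k
      omega) (m + 1) (0, 0, 0)
  have zero_eq : (tabulate fun _ : Fin n => (pure 0 : Timed ℝ)).val = 0 := rfl
  rw [clenshawProg]
  simp only [steps_bind, zero_eq, steps_dotProg, rmul, radd, rsub, rdiv, steps_instr]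
  rw [steps_tabulate_of_const (K := 0) (fun _ => rfl),
    steps_tabulate_of_const (K := 1) (fun _ => rfl)]
  have h₀ := steps_coeffProg_le u 0
  have h₁ : (m + 1) * (19 * nnz R + 1) + 19 * nnz R ≤ (m + 1) * (39 * nnz R) := by nlinarith
  have h₂ : n * (0 + 1) + n * 3 + n * (1 + 1) + n * 3 + 7 + 3 ≤ 19 * nnz R := by omega
  refine le_trans ?_ h₁
  simp only [rdiv, rmul, radd, rsub] at key
  omega

/-! ### The whole program -/

theorem val_entropyProg (R : Matrix (Fin n) (Fin n) ℝ) (hR : ∀ x, 0 ≤ rayleigh R x)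
    (ℓ ε δ : ℝ) (ω : Tape n) :
    (entropyProg (sparseRows R) ℓ ε δ ω).val = entropyEstimate R ℓ ε δ ω := by
  have hq : (powerRepsProg δ).val = powerReps δ := rfl
  have ht : (powerItersProg n).val = powerIters n := rfl
  have hs : (numSamplesProg ε δ).val = numSamples ε δ := by
    rw [numSamples, sq]; rfl
  have hm : ∀ u, (chebDegreeProg ℓ ε u).val = chebDegree ℓ ε u := fun _ => rfl
  have hu : min 1 (6 * powerEstimate R (powerReps δ) (powerIters n) ω)
    = upperEstimate R δ ω := rfl
  rw [entropyProg]
  simp only [val_bind, hq, ht, hs, hm, rmul, rmin, radd, rneg, rdiv, castReal, val_instr,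
    val_powerProg R hR, hu]
  rw [val_loop_sum _ (fun k => gaussVec ω k ⬝ᵥ (Polynomial.aeval R (chebApprox
    (upperEstimate R δ ω) (chebDegree ℓ ε (upperEstimate R δ ω))) *ᵥ gaussVec ω k))]
  · rw [entropyEstimate, traceEstimate]
    ring
  · intro k b
    simp only [val_bind, val_instr, val_clenshawProg]
    rfl

theorem steps_entropyProg_le (R : Matrix (Fin n) (Fin n) ℝ) (hR : ∀ x, 0 ≤ rayleigh R x)
    (hn : n ≤ nnz R) (hn₁ : 1 ≤ n) (ℓ ε δ : ℝ) (ω : Tape n) :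
    (entropyProg (sparseRows R) ℓ ε δ ω).steps
      ≤ powerReps δ * ((15 + 5 * powerIters n) * nnz R)
        + numSamples ε δ * ((chebDegree ℓ ε (upperEstimate R δ ω) + 1) * (43 * nnz R)) + 29 := by
  have hq : (powerRepsProg δ).val = powerReps δ := rfl
  have ht : (powerItersProg n).val = powerIters n := rfl
  have hs : (numSamplesProg ε δ).val = numSamples ε δ := by
    rw [numSamples, sq]; rfl
  have hm : ∀ u, (chebDegreeProg ℓ ε u).val = chebDegree ℓ ε u := fun _ => rfl
  have hu : min 1 (6 * powerEstimate R (powerReps δ) (powerIters n) ω)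
    = upperEstimate R δ ω := rfl
  -- The final `29` is `4 + 5 + 9 + 6` for the parameters plus five scalar operations outside the
  -- loops.
  have hq' : (powerRepsProg δ).steps = 4 := rfl
  have ht' : (powerItersProg n).steps = 5 := rfl
  have hs' : (numSamplesProg ε δ).steps = 6 := rfl
  have hm' : ∀ u, (chebDegreeProg ℓ ε u).steps = 9 := fun _ => rfl
  rw [entropyProg]
  simp only [steps_bind, hq, ht, hs, hm, hq', ht', hs', hm', rmul, rmin, rneg, rdiv,
    castReal, val_instr, steps_instr, val_powerProg R hR, hu]
  have h₁ := steps_powerProg_le R hn hn₁ (powerReps δ) (powerIters n) ω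
  set m := chebDegree ℓ ε (upperEstimate R δ ω)
  have h₂ := steps_loop_le (fun k acc => do
    let g ← tabulate fun i => drawGauss ω k i
    let v ← clenshawProg (sparseRows R) (upperEstimate R δ ω) m g
    radd acc v) (K := (m + 1) * (42 * nnz R)) (by
      intro k b
      simp only [steps_bind, radd, steps_instr]
      rw [steps_tabulate_of_const (K := 1) (fun _ => rfl)]
      have := steps_clenshawProg_le R hn hn₁ (upperEstimate R δ ω) m
        (tabulate fun i => drawGauss ω k i).val
      nlinarith) (numSamples ε δ) 0
  have h₃ : numSamples ε δ * ((m + 1) * (42 * nnz R) + 1)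
      ≤ numSamples ε δ * ((m + 1) * (43 * nnz R)) := Nat.mul_le_mul_left _ (by nlinarith)
  omega

end

section

/-! ### The Chebyshev expansion of `x ln x` -/

/-- Telescoping: `1/((k+1)(k+2)(k+3))` is half the difference of `1/((k+1)(k+2))` and
`1/((k+2)(k+3))`. -/
theorem sum_range_inv_three_consecutive (m N : ℕ) :
    ∑ i ∈ Finset.range N, 1 / (((i + m : ℕ) + 1 : ℝ) * ((i + m : ℕ) + 2) * ((i + m : ℕ) + 3))
      = 1 / (2 * ((m : ℝ) + 1) * (m + 2))
        - 1 / (2 * (((N : ℝ) + m) + 1) * ((N : ℝ) + m + 2)) := by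
  induction N with
  | zero => simp
  | succ N ih =>
    rw [Finset.sum_range_succ, ih]
    push_cast
    have h₁ : (N : ℝ) + m + 1 ≠ 0 := by positivity
    have h₂ : (N : ℝ) + m + 2 ≠ 0 := by positivity
    have h₃ : (N : ℝ) + m + 3 ≠ 0 := by positivity
    have h₄ : (N : ℝ) + 1 + m + 1 = N + m + 2 := by ring
    have h₅ : (N : ℝ) + 1 + m + 2 = N + m + 3 := by ring
    rw [h₄, h₅]
    field_simp
    ring

theorem hasSum_inv_three_consecutive (m : ℕ) :
    HasSum (fun i : ℕ => 1 / (((i + m : ℕ) + 1 : ℝ) * ((i + m : ℕ) + 2) * ((i + m : ℕ) + 3)))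
      (1 / (2 * ((m : ℝ) + 1) * (m + 2))) := by
  rw [hasSum_iff_tendsto_nat_of_nonneg (fun i => by positivity)]
  simp_rw [sum_range_inv_three_consecutive]
  nth_rewrite 2 [← sub_zero (1 / (2 * ((m : ℝ) + 1) * (m + 2)))]
  refine Filter.Tendsto.const_sub _ ?_
  have h : Filter.Tendsto (fun N : ℕ => 1 / ((N : ℝ) + 1)) Filter.atTop (nhds 0) :=
    tendsto_one_div_add_atTop_nhds_zero_nat
  refine squeeze_zero (fun N => by positivity) (fun N => ?_) h
  refine one_div_le_one_div_of_le (by positivity) ?_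
  have hN : (0 : ℝ) ≤ N := by positivity
  have hm : (0 : ℝ) ≤ m := by positivity
  nlinarith [mul_nonneg hN hm]

/-- By partial fractions the general term is a combination of `1/(w+1)`, `-2/(w+2)` and `1/(w+3)`
with factor `1/2`. These are three shifts of the series of `log (1 + z)`, weighted by `z`, `2` and
`z⁻¹`, and `z + 2 + z⁻¹ = (1+z)²/z`. -/
theorem hasSum_chebSeries_of_norm_lt_one {z : ℂ} (hz : ‖z‖ < 1) (hz₀ : z ≠ 0) :
    HasSum (fun w : ℕ => (-1) ^ w * z ^ (w + 2) / (((w : ℂ) + 1) * (w + 2) * (w + 3)))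
      (((1 + z) ^ 2 / z * Complex.log (1 + z) - 1 - 3 / 2 * z) / 2) := by
  have h := Complex.hasSum_taylorSeries_log hz
  have hA := (hasSum_nat_add_iff' 1).2 h
  have hB := (hasSum_nat_add_iff' 2).2 h
  have hC := (hasSum_nat_add_iff' 3).2 h
  have key := (((hA.mul_left z).add (hB.mul_left 2)).add (hC.mul_left z⁻¹)).mul_left (1 / 2)
  convert! key using 1
  · funext w
    have h₁ : (w : ℂ) + 1 ≠ 0 := by exact_mod_cast Nat.succ_ne_zero w
    have h₂ : (w : ℂ) + 2 ≠ 0 := by exact_mod_cast Nat.succ_ne_zero (w + 1)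
    have h₃ : (w : ℂ) + 3 ≠ 0 := by exact_mod_cast Nat.succ_ne_zero (w + 2)
    push_cast
    field_simp
    ring
  · simp only [Finset.sum_range_succ, Finset.sum_range_zero]
    push_cast
    field_simp
    ring

/-- Passage to the unit circle along `r z`, `r → 1⁻`: the cubic denominators dominate the series
uniformly, and the closed form is continuous because `1 + z` avoids the branch cut. -/
theorem hasSum_chebSeries {z : ℂ} (hz : ‖z‖ = 1) (hz₁ : 1 + z ∈ Complex.slitPlane) :
    HasSum (fun w : ℕ => (-1) ^ w * z ^ (w + 2) / (((w : ℂ) + 1) * (w + 2) * (w + 3)))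
      (((1 + z) ^ 2 / z * Complex.log (1 + z) - 1 - 3 / 2 * z) / 2) := by
  have hz₀ : z ≠ 0 := by
    rintro rfl
    simp at hz
  have hb := hasSum_inv_three_consecutive 0
  simp only [add_zero] at hb
  have norm_le : ∀ (ζ : ℂ), ‖ζ‖ ≤ 1 → ∀ w : ℕ,
      ‖(-1) ^ w * ζ ^ (w + 2) / (((w : ℂ) + 1) * (w + 2) * (w + 3))‖
        ≤ 1 / (((w : ℝ) + 1) * (w + 2) * (w + 3)) := by
    intro ζ hζ w
    have h₀ : (((w : ℂ) + 1) * (w + 2) * (w + 3)) = (((w + 1) * (w + 2) * (w + 3) : ℕ) : ℂ) := by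
      push_cast; ring
    rw [h₀, norm_div, norm_mul, norm_pow, norm_pow, norm_neg, norm_one, one_pow, one_mul,
      Complex.norm_natCast]
    push_cast
    gcongr
    exact pow_le_one₀ (norm_nonneg _) hζ
  have hsum : Summable (fun w : ℕ =>
      (-1) ^ w * z ^ (w + 2) / (((w : ℂ) + 1) * (w + 2) * (w + 3))) :=
    Summable.of_norm_bounded hb.summable (norm_le z hz.le)
  have lim₁ : Filter.Tendsto (fun r : ℝ => ∑' w : ℕ,
      (-1) ^ w * ((r : ℂ) * z) ^ (w + 2) / (((w : ℂ) + 1) * (w + 2) * (w + 3)))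
      (nhdsWithin 1 (Set.Ioo 0 1))
      (nhds (∑' w : ℕ, (-1) ^ w * z ^ (w + 2) / (((w : ℂ) + 1) * (w + 2) * (w + 3)))) := by
    refine tendsto_tsum_of_dominated_convergence hb.summable ?_ ?_
    · intro w
      have : Continuous fun r : ℝ =>
          (-1) ^ w * ((r : ℂ) * z) ^ (w + 2) / (((w : ℂ) + 1) * (w + 2) * (w + 3)) := by fun_prop
      have := (this.tendsto 1).mono_left (nhdsWithin_le_nhds (s := Set.Ioo 0 1))
      simpa using this
    · filter_upwards [self_mem_nhdsWithin] with r hr w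
      refine norm_le _ ?_ w
      rw [norm_mul, hz, mul_one, Complex.norm_real, Real.norm_eq_abs, abs_of_pos hr.1]
      exact hr.2.le
  have lim₂ : Filter.Tendsto (fun r : ℝ =>
      ((1 + (r : ℂ) * z) ^ 2 / (r * z) * Complex.log (1 + r * z) - 1 - 3 / 2 * (r * z)) / 2)
      (nhdsWithin 1 (Set.Ioo 0 1))
      (nhds (((1 + z) ^ 2 / z * Complex.log (1 + z) - 1 - 3 / 2 * z) / 2)) := by
    have : ContinuousAt (fun r : ℝ =>
      ((1 + (r : ℂ) * z) ^ 2 / (r * z) * Complex.log (1 + r * z) - 1 - 3 / 2 * (r * z)) / 2) 1 := by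
      have c₀ : ContinuousAt (fun r : ℝ => (r : ℂ) * z) 1 := by fun_prop
      have c₁ : ContinuousAt (fun r : ℝ => Complex.log (1 + r * z)) 1 :=
        (continuousAt_const.add c₀).clog (by simpa using hz₁)
      exact ((((((continuousAt_const.add c₀).pow 2).div c₀ (by simpa using hz₀)).mul c₁).sub
        continuousAt_const).sub (continuousAt_const.mul c₀)).div_const 2
    have := this.tendsto.mono_left (nhdsWithin_le_nhds (s := Set.Ioo 0 1))
    simpa using this
  have hne : (nhdsWithin (1 : ℝ) (Set.Ioo 0 1)).NeBot :=
    right_nhdsWithin_Ioo_neBot zero_lt_one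
  have heq : (fun r : ℝ => ∑' w : ℕ,
      (-1) ^ w * ((r : ℂ) * z) ^ (w + 2) / (((w : ℂ) + 1) * (w + 2) * (w + 3)))
      =ᶠ[nhdsWithin 1 (Set.Ioo 0 1)] (fun r : ℝ =>
      ((1 + (r : ℂ) * z) ^ 2 / (r * z) * Complex.log (1 + r * z) - 1 - 3 / 2 * (r * z)) / 2) := by
    filter_upwards [self_mem_nhdsWithin] with r hr
    refine (hasSum_chebSeries_of_norm_lt_one ?_ ?_).tsum_eq
    · rw [norm_mul, hz, mul_one, Complex.norm_real, Real.norm_eq_abs, abs_of_pos hr.1]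
      exact hr.2
    · exact mul_ne_zero (by exact_mod_cast hr.1.ne') hz₀
  rw [← tendsto_nhds_unique (lim₁.congr' heq) lim₂]
  exact hsum.hasSum

theorem chebCoeff_add_two (u : ℝ) (w : ℕ) :
    chebCoeff u (w + 2) = u * ((-1) ^ w / (((w : ℝ) + 1) * (w + 2) * (w + 3))) := by
  have h : (((w + 2 : ℕ) : ℝ) ^ 3 - ((w + 2 : ℕ) : ℝ)) = ((w : ℝ) + 1) * (w + 2) * (w + 3) := by
    push_cast; ring
  rw [chebCoeff, h, pow_add]
  ring

/-- `∑_{w ≥ 2} α_w cos (w θ)` in closed form. -/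
theorem hasSum_chebCoeff_cos {u x θ : ℝ} (hu : 0 < u) (hx : 0 < x)
    (hθ : Real.cos θ = 2 / u * x - 1) :
    HasSum (fun w : ℕ => chebCoeff u (w + 2) * Real.cos ((w + 2 : ℕ) * θ))
      (x * Real.log x - chebCoeff u 0 - chebCoeff u 1 * Real.cos θ) := by
  -- `x > 0` excludes `z = -1`, the only point of the unit circle where `1 + z` leaves the slit
  -- plane.
  have hc : 0 < 1 + Real.cos θ := by
    rw [hθ]
    have : 0 < 2 / u * x := by positivity
    linarith
  set z : ℂ := Complex.exp (θ * Complex.I) with hzdef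
  have hz : ‖z‖ = 1 := Complex.norm_exp_ofReal_mul_I θ
  have hre : z.re = Real.cos θ := Complex.exp_ofReal_mul_I_re θ
  have him : z.im = Real.sin θ := Complex.exp_ofReal_mul_I_im θ
  have hz₁ : 1 + z ∈ Complex.slitPlane := by
    left
    rw [Complex.add_re, Complex.one_re, hre]
    exact hc
  have hnorm : ‖1 + z‖ ^ 2 = 2 * (1 + Real.cos θ) := by
    rw [← Complex.normSq_eq_norm_sq, Complex.normSq_apply]
    simp only [Complex.add_re, Complex.one_re, Complex.add_im, Complex.one_im, hre, him]
    nlinarith [Real.sin_sq_add_cos_sq θ]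
  have hlog : Real.log ‖1 + z‖ = Real.log (2 * (1 + Real.cos θ)) / 2 := by
    rw [← hnorm, Real.log_pow]
    push_cast
    ring
  -- This factor is real, so taking real parts of the series only sees `log ‖1 + z‖`.
  have hsq : (1 + z) ^ 2 / z = ((2 * (1 + Real.cos θ) : ℝ) : ℂ) := by
    have hz₀ : z ≠ 0 := Complex.exp_ne_zero _
    have h : z = Real.cos θ + Real.sin θ * Complex.I := by
      rw [hzdef, Complex.exp_mul_I, Complex.ofReal_cos, Complex.ofReal_sin]
    have hI := Complex.I_sq
    have hs : (Real.sin θ : ℂ) ^ 2 + (Real.cos θ : ℂ) ^ 2 = 1 := by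
      exact_mod_cast Real.sin_sq_add_cos_sq θ
    rw [div_eq_iff hz₀]
    push_cast
    rw [h]
    push_cast at hs ⊢
    linear_combination (Complex.sin θ) ^ 2 * hI - hs
  have H := Complex.hasSum_re (hasSum_chebSeries hz hz₁)
  have H' := H.mul_left u
  convert! H' using 1
  · funext w
    have h₁ : (-1) ^ w * z ^ (w + 2) / (((w : ℂ) + 1) * (w + 2) * (w + 3))
        = (((-1) ^ w / (((w : ℝ) + 1) * (w + 2) * (w + 3)) : ℝ) : ℂ)
          * Complex.exp ((((w + 2 : ℕ) * θ : ℝ) : ℂ) * Complex.I) := by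
      rw [hzdef, ← Complex.exp_nat_mul]
      push_cast
      rw [show ((w : ℂ) + 2) * (θ * Complex.I) = (w + 2) * θ * Complex.I by ring]
      ring
    rw [h₁, Complex.re_ofReal_mul, Complex.exp_ofReal_mul_I_re, chebCoeff_add_two, mul_assoc]
  · rw [hsq]
    have h₂ : ((((2 * (1 + Real.cos θ) : ℝ) : ℂ) * Complex.log (1 + z) - 1 - 3 / 2 * z) / 2).re
        = ((2 * (1 + Real.cos θ)) * Real.log ‖1 + z‖ - 1 - 3 / 2 * Real.cos θ) / 2 := by
      rw [show (2 : ℂ) = ((2 : ℝ) : ℂ) by norm_num, Complex.div_ofReal_re, Complex.sub_re,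
        Complex.sub_re, Complex.re_ofReal_mul, Complex.log_re, Complex.one_re,
        show (3 : ℂ) / ((2 : ℝ) : ℂ) = ((3 / 2 : ℝ) : ℂ) by push_cast; norm_num,
        Complex.re_ofReal_mul, hre]
    have h₃ : Real.log (u / 4) = Real.log x - Real.log (2 * (1 + Real.cos θ)) := by
      rw [hθ, ← Real.log_div hx.ne' (by rw [hθ] at hc; positivity)]
      congr 1
      field_simp
      ring
    rw [h₂, hlog, chebCoeff, chebCoeff, h₃]
    have h₄ : Real.cos θ * u = 2 * x - u := by
      rw [hθ]
      field_simp
    generalize Real.log (2 * (1 + Real.cos θ)) = L at *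
    linear_combination (-Real.log x / 2) * h₄

theorem eval_chebApprox (u : ℝ) (m : ℕ) (x : ℝ) {θ : ℝ} (hθ : Real.cos θ = 2 / u * x - 1) :
    (chebApprox u m).eval x = ∑ w ∈ Finset.range (m + 1), chebCoeff u w * Real.cos (w * θ) := by
  rw [chebApprox, Polynomial.eval_finsetSum]
  refine Finset.sum_congr rfl fun w _ => ?_
  rw [Polynomial.eval_mul, Polynomial.eval_C, Polynomial.eval_comp, Polynomial.eval_sub,
    Polynomial.eval_mul, Polynomial.eval_C, Polynomial.eval_X, Polynomial.eval_one, ← hθ,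
    Polynomial.Chebyshev.T_real_cos]
  push_cast
  rfl

/-- The truncated Chebyshev expansion of `x ln x` on `(0, u]` has error at most
`u / (2 m (m + 1))`. -/
theorem abs_chebApprox_sub_le {u x : ℝ} (hu : 0 < u) (hx : 0 < x) (hxu : x ≤ u) {m : ℕ}
    (hm : 1 ≤ m) :
    |(chebApprox u m).eval x - x * Real.log x| ≤ u / (2 * m * (m + 1)) := by
  obtain ⟨k, rfl⟩ : ∃ k, m = k + 1 := ⟨m - 1, by omega⟩
  have hθ : Real.cos (Real.arccos (2 / u * x - 1)) = 2 / u * x - 1 := by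
    have h₀ : 0 < 2 / u * x := by positivity
    have h₁ : 2 / u * x ≤ 2 := by
      rw [div_mul_eq_mul_div, div_le_iff₀ hu]
      linarith
    exact Real.cos_arccos (by linarith) (by linarith)
  set θ := Real.arccos (2 / u * x - 1)
  -- The series starts at `w = 2`, so dropping `k = m - 1` terms leaves exactly the indices `w > m`.
  have H := (hasSum_nat_add_iff' k).2 (hasSum_chebCoeff_cos hu hx hθ)
  have hsum : (chebApprox u (k + 1)).eval x = chebCoeff u 0 + chebCoeff u 1 * Real.cos θ
      + ∑ w ∈ Finset.range k, chebCoeff u (w + 2) * Real.cos ((w + 2 : ℕ) * θ) := by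
    rw [eval_chebApprox u _ x hθ, Finset.sum_range_succ', Finset.sum_range_succ']
    simp only [zero_add, Nat.cast_zero, zero_mul, Real.cos_zero, mul_one, Nat.cast_one, one_mul]
    rw [add_assoc, add_comm, add_comm (chebCoeff u 0)]
  have hb := (hasSum_inv_three_consecutive k).mul_left u
  have := H.norm_le_of_bounded hb fun i => by
    rw [norm_mul, chebCoeff_add_two, norm_mul, norm_div, norm_pow, norm_neg, norm_one, one_pow,
      Real.norm_of_nonneg hu.le, Real.norm_of_nonneg (by positivity)]
    exact mul_le_of_le_one_right (by positivity) (Real.abs_cos_le_one _)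
  rw [Real.norm_eq_abs, abs_sub_comm] at this
  rw [hsum]
  convert this using 1
  · congr 1
    ring
  · push_cast
    rw [mul_one_div]
    ring_nf

end

section

variable {n : ℕ}

/-! ### Quadratic forms in an eigenbasis -/

/-- The coordinates of `x` in the eigenbasis of a symmetric matrix. -/
def eigenCoord {R : Matrix (Fin n) (Fin n) ℝ} (hR : R.IsHermitian) (x : Fin n → ℝ) (i : Fin n) :
    ℝ :=
  hR.eigenvectorBasis.repr (WithLp.toLp 2 x) i

variable {R : Matrix (Fin n) (Fin n) ℝ} (hR : R.IsHermitian)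

theorem eigenCoord_eq_dotProduct (x : Fin n → ℝ) (i : Fin n) :
    eigenCoord hR x i = (hR.eigenvectorBasis i).ofLp ⬝ᵥ x := by
  rw [eigenCoord, OrthonormalBasis.repr_apply_apply, dotProduct_comm]
  simp [PiLp.inner_apply, dotProduct]

theorem dotProduct_eq_sum_eigenCoord (x y : Fin n → ℝ) :
    x ⬝ᵥ y = ∑ i, eigenCoord hR x i * eigenCoord hR y i := by
  have h := hR.eigenvectorBasis.repr.inner_map_map (WithLp.toLp 2 x) (WithLp.toLp 2 y)
  simp only [PiLp.inner_apply] at h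
  simp only [eigenCoord, dotProduct]
  simpa [mul_comm] using h.symm

theorem eigenCoord_mulVec (x : Fin n → ℝ) (i : Fin n) :
    eigenCoord hR (R *ᵥ x) i = hR.eigenvalues i * eigenCoord hR x i := by
  have hT : Rᵀ = R := by simpa using hR.eq
  rw [eigenCoord_eq_dotProduct, eigenCoord_eq_dotProduct, Matrix.dotProduct_mulVec,
    ← Matrix.mulVec_transpose, hT, hR.mulVec_eigenvectorBasis, smul_dotProduct, smul_eq_mul]

theorem eigenCoord_aeval_mulVec (P : Polynomial ℝ) (x : Fin n → ℝ) (i : Fin n) :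
    eigenCoord hR (Polynomial.aeval R P *ᵥ x) i
      = P.eval (hR.eigenvalues i) * eigenCoord hR x i := by
  induction P using Polynomial.induction_on' generalizing x with
  | add p q hp hq =>
    rw [map_add, Matrix.add_mulVec, Polynomial.eval_add, add_mul, ← hp, ← hq]
    simp only [eigenCoord_eq_dotProduct, dotProduct_add]
  | monomial k a =>
    rw [Polynomial.aeval_monomial, Polynomial.eval_monomial, ← Algebra.smul_def,
      Matrix.smul_mulVec]
    have h : eigenCoord hR (R ^ k *ᵥ x) i = hR.eigenvalues i ^ k * eigenCoord hR x i := by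
      induction k with
      | zero => simp
      | succ k ih =>
        rw [pow_succ', ← Matrix.mulVec_mulVec, eigenCoord_mulVec, ih, pow_succ', mul_assoc]
    rw [mul_assoc, ← h]
    simp only [eigenCoord_eq_dotProduct, dotProduct_smul, smul_eq_mul]

theorem dotProduct_aeval_mulVec (P : Polynomial ℝ) (x : Fin n → ℝ) :
    x ⬝ᵥ (Polynomial.aeval R P *ᵥ x)
      = ∑ i, P.eval (hR.eigenvalues i) * eigenCoord hR x i ^ 2 := by
  rw [dotProduct_eq_sum_eigenCoord hR]
  refine Finset.sum_congr rfl fun i _ => ?_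
  rw [eigenCoord_aeval_mulVec]
  ring

/-! ### Rows of an i.i.d. array -/

section Rows

variable {X : Type*} [MeasurableSpace X] (P : Measure X) [IsProbabilityMeasure P]

theorem map_row_infinitePi (k : ℕ) :
    (Measure.infinitePi fun _ : ℕ × Fin n => P).map (fun a i => a (k, i))
      = Measure.pi fun _ : Fin n => P := by
  rw [Measure.map_infinitePi_infinitePi_of_inj (P := fun _ : ℕ × Fin n => P)
    (f := fun i : Fin n => (k, i)) (fun i j h => (Prod.ext_iff.1 h).2), Measure.infinitePi_eq_pi]

/-- Currying identifies the product measure on the array with the product over rows of the row laws.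
-/
theorem iIndepFun_row_infinitePi :
    iIndepFun (fun (k : ℕ) (a : ℕ × Fin n → X) (i : Fin n) => a (k, i))
      (Measure.infinitePi fun _ : ℕ × Fin n => P) := by
  rw [iIndepFun_iff_map_fun_eq_infinitePi_map (by fun_prop)]
  simp_rw [map_row_infinitePi]
  have h := Measure.infinitePi_map_curry (fun (_ : ℕ) (_ : Fin n) => P)
  simp_rw [Measure.infinitePi_eq_pi (ι := Fin n)] at h
  exact h

end Rows

/-! ### Concentration of the Gaussian trace estimator -/

/-- The weight merges with the density into the unnormalised Gaussian `exp (-(1/2 - t) x²)`. -/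
theorem integral_exp_mul_sq_gaussianReal {t : ℝ} (ht : t < 1 / 2) :
    ∫ x, Real.exp (t * x ^ 2) ∂(gaussianReal 0 1) = Real.sqrt (1 / (1 - 2 * t)) := by
  rw [integral_gaussianReal_eq_integral_smul one_ne_zero]
  have h : ∀ x : ℝ, gaussianPDFReal 0 1 x • Real.exp (t * x ^ 2)
      = (Real.sqrt (2 * Real.pi))⁻¹ * Real.exp (-(1 / 2 - t) * x ^ 2) := by
    intro x
    rw [gaussianPDFReal, smul_eq_mul, mul_assoc, ← Real.exp_add]
    simp only [NNReal.coe_one, mul_one, sub_zero]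
    congr 2
    ring
  simp_rw [h]
  rw [integral_const_mul, integral_gaussian, ← Real.sqrt_inv, ← Real.sqrt_mul (by positivity)]
  congr 1
  have : (1 : ℝ) / 2 - t ≠ 0 := by linarith
  have : (1 : ℝ) - 2 * t ≠ 0 := by linarith
  have : Real.pi ≠ 0 := Real.pi_ne_zero
  field_simp

theorem integrable_exp_mul_sq_gaussianReal {t : ℝ} (ht : t < 1 / 2) :
    Integrable (fun x => Real.exp (t * x ^ 2)) (gaussianReal 0 1) := by
  -- A nonintegrable function has integral `0` by convention, so a positive value forces
  -- integrability.
  refine .of_integral_ne_zero ?_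
  rw [integral_exp_mul_sq_gaussianReal ht]
  have : 0 < 1 - 2 * t := by linarith
  positivity

/-- Amounts to `-½ ln (1 - 2t) ≤ t + 4t²`: the remainder of the logarithm after its linear term is
at most `(2t)²/(1 - |2t|) ≤ 8t²`. -/
theorem integral_exp_mul_sq_gaussianReal_le {t : ℝ} (ht : |t| ≤ 1 / 4) :
    ∫ x, Real.exp (t * x ^ 2) ∂(gaussianReal 0 1) ≤ Real.exp (t + 4 * t ^ 2) := by
  obtain ⟨h₁, h₂⟩ := abs_le.1 ht
  rw [integral_exp_mul_sq_gaussianReal (by linarith)]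
  have hpos : 0 < 1 - 2 * t := by linarith
  have habs : |2 * t| ≤ 1 / 2 := by
    rw [abs_mul, abs_two]
    linarith
  have h := Real.abs_log_sub_add_sum_range_le (x := 2 * t) (by linarith) 1
  simp only [Finset.sum_range_one, zero_add, pow_one, Nat.cast_zero, div_one] at h
  have h' : |2 * t| ^ (1 + 1) / (1 - |2 * t|) ≤ 8 * t ^ 2 := by
    rw [div_le_iff₀ (by linarith), sq_abs]
    nlinarith [sq_nonneg t]
  have h₃ := (abs_le.1 (h.trans h')).1
  rw [Real.sqrt_le_left (Real.exp_pos _).le, ← Real.exp_nat_mul, one_div, inv_le_comm₀ hpos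
    (Real.exp_pos _), ← Real.exp_neg, ← Real.le_log_iff_exp_le hpos]
  push_cast
  linarith

/-- Rotation invariance: a linear isometry preserves the standard Gaussian measure. -/
theorem map_repr_pi_gaussianReal (b : OrthonormalBasis (Fin n) ℝ (EuclideanSpace ℝ (Fin n))) :
    (Measure.pi fun _ : Fin n => gaussianReal 0 1).map
      (fun x i => b.repr (WithLp.toLp 2 x) i) = Measure.pi fun _ => gaussianReal 0 1 := by
  have h₁ : (Measure.pi fun _ : Fin n => gaussianReal 0 1).map (WithLp.toLp 2)
      = stdGaussian (EuclideanSpace ℝ (Fin n)) := map_pi_eq_stdGaussian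
  have h₂ : (stdGaussian (EuclideanSpace ℝ (Fin n))).map b.repr
      = stdGaussian (EuclideanSpace ℝ (Fin n)) := stdGaussian_map b.repr
  have h₃ : (stdGaussian (EuclideanSpace ℝ (Fin n))).map WithLp.ofLp
      = Measure.pi fun _ : Fin n => gaussianReal 0 1 := by
    rw [← h₁, Measure.map_map (by fun_prop) (by fun_prop)]
    exact Measure.map_id
  calc (Measure.pi fun _ : Fin n => gaussianReal 0 1).map
        (fun x i => b.repr (WithLp.toLp 2 x) i)
      = (((Measure.pi fun _ : Fin n => gaussianReal 0 1).map (WithLp.toLp 2)).map b.repr).map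
          WithLp.ofLp := by
        rw [Measure.map_map (by fun_prop) (by fun_prop),
          Measure.map_map (by fun_prop) (by fun_prop)]
        rfl
    _ = _ := by rw [h₁, h₂, h₃]

theorem measurable_eigenCoord (i : Fin n) : Measurable fun x => eigenCoord hR x i := by
  simp_rw [eigenCoord_eq_dotProduct, dotProduct]
  fun_prop

theorem map_eigenCoord_pi_gaussianReal :
    (Measure.pi fun _ : Fin n => gaussianReal 0 1).map (fun x i => eigenCoord hR x i)
      = Measure.pi fun _ => gaussianReal 0 1 :=
  map_repr_pi_gaussianReal hR.eigenvectorBasis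

/-- Moment generating function of a nonnegative combination of squares of Gaussians. -/
theorem mgf_sum_mul_sq {a : Fin n → ℝ} (ha : ∀ i, 0 ≤ a i) {t : ℝ}
    (ht : |t| * ∑ i, a i ≤ 1 / 4) :
    Integrable (fun z : Fin n → ℝ => Real.exp (t * ∑ i, a i * z i ^ 2))
        (Measure.pi fun _ => gaussianReal 0 1) ∧
      ∫ z : Fin n → ℝ, Real.exp (t * ∑ i, a i * z i ^ 2) ∂(Measure.pi fun _ => gaussianReal 0 1)
        ≤ Real.exp (t * ∑ i, a i + 4 * (t * ∑ i, a i) ^ 2) := by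
  have hprod : (fun z : Fin n → ℝ => Real.exp (t * ∑ i, a i * z i ^ 2))
      = fun z => ∏ i, Real.exp (t * a i * z i ^ 2) := by
    funext z
    rw [← Real.exp_sum, Finset.mul_sum]
    simp_rw [mul_assoc]
  have hle : ∀ i, a i ≤ ∑ j, a j := fun i =>
    Finset.single_le_sum (fun j _ => ha j) (Finset.mem_univ i)
  have hta : ∀ i, |t * a i| ≤ 1 / 4 := by
    intro i
    rw [abs_mul, abs_of_nonneg (ha i)]
    exact (mul_le_mul_of_nonneg_left (hle i) (abs_nonneg t)).trans ht
  rw [hprod]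
  constructor
  · exact Integrable.fintype_prod (f := fun i x => Real.exp (t * a i * x ^ 2)) fun i =>
      integrable_exp_mul_sq_gaussianReal (by linarith [(abs_le.1 (hta i)).2])
  · rw [integral_fintype_prod_eq_prod (fun i x => Real.exp (t * a i * x ^ 2))]
    calc ∏ i, ∫ x, Real.exp (t * a i * x ^ 2) ∂(gaussianReal 0 1)
        ≤ ∏ i, Real.exp (t * a i + 4 * (t * a i) ^ 2) :=
          Finset.prod_le_prod (fun i _ => integral_nonneg fun x => (Real.exp_pos _).le)
            fun i _ => integral_exp_mul_sq_gaussianReal_le (hta i)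
      _ = Real.exp (t * ∑ i, a i + 4 * t ^ 2 * ∑ i, a i ^ 2) := by
          rw [← Real.exp_sum, Finset.sum_add_distrib, Finset.mul_sum, Finset.mul_sum]
          congr 2
          refine Finset.sum_congr rfl fun i _ => by ring
      -- `∑ aᵢ² ≤ (∑ aᵢ)²` for nonnegative `aᵢ`. This makes the bound depend on the trace alone.
      _ ≤ _ := by
          rw [mul_pow, ← mul_assoc]
          gcongr
          rw [sq, Finset.sum_mul]
          exact Finset.sum_le_sum fun i _ => by
            rw [sq]
            exact mul_le_mul_of_nonneg_left (hle i) (ha i)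

/-- Concentration of the sum of `s` independent Gaussian quadratic forms with nonnegative
eigenvalues. -/
theorem measureReal_gaussian_quadratic_le {a : Fin n → ℝ} (ha : ∀ i, 0 ≤ a i)
    (hpos : 0 < ∑ i, a i) {ε : ℝ} (hε : 0 < ε) (hε₁ : ε < 1) (s : ℕ) :
    (Measure.infinitePi fun _ : ℕ × Fin n => gaussianReal 0 1).real
      {b | ¬ |∑ k ∈ Finset.range s, ∑ i, a i * eigenCoord hR (fun j => b (k, j)) i ^ 2
        - s * ∑ i, a i| ≤ ε * (s * ∑ i, a i)} ≤ 2 * Real.exp (-(s * ε ^ 2 / 16)) := by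
  set ν := Measure.infinitePi fun _ : ℕ × Fin n => gaussianReal 0 1 with hν
  set T := ∑ i, a i with hT
  set Q : ℕ → (ℕ × Fin n → ℝ) → ℝ :=
    fun k b => ∑ i, a i * eigenCoord hR (fun j => b (k, j)) i ^ 2 with hQ
  have hform : Measurable fun x : Fin n → ℝ => ∑ i, a i * eigenCoord hR x i ^ 2 :=
    Finset.measurable_fun_sum _ fun i _ => ((measurable_eigenCoord hR i).pow_const 2).const_mul _
  have hrow : ∀ k : ℕ, Measurable fun (b : ℕ × Fin n → ℝ) (j : Fin n) => b (k, j) := by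
    intro k
    fun_prop
  have hmeas : ∀ k, Measurable (Q k) := fun k => hform.comp (hrow k)
  have hind : iIndepFun Q ν :=
    (iIndepFun_row_infinitePi (n := n) (gaussianReal 0 1)).comp
      (fun _ x => ∑ i, a i * eigenCoord hR x i ^ 2) fun _ => hform
  have hlaw : ∀ k, ν.map (fun b i => eigenCoord hR (fun j => b (k, j)) i)
      = Measure.pi fun _ : Fin n => gaussianReal 0 1 := by
    intro k
    rw [← map_eigenCoord_pi_gaussianReal hR, ← map_row_infinitePi (gaussianReal 0 1) k,
      Measure.map_map (measurable_pi_iff.2 (measurable_eigenCoord hR)) (hrow k)]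
    rfl
  have hcoord : ∀ k, Measurable fun (b : ℕ × Fin n → ℝ) (i : Fin n) =>
      eigenCoord hR (fun j => b (k, j)) i := fun k =>
    measurable_pi_iff.2 fun i => (measurable_eigenCoord hR i).comp (hrow k)
  have hmgf : ∀ {t : ℝ}, |t| * T ≤ 1 / 4 → ∀ k,
      Integrable (fun b => Real.exp (t * Q k b)) ν ∧
        mgf (Q k) ν t ≤ Real.exp (t * T + 4 * (t * T) ^ 2) := by
    intro t ht k
    obtain ⟨h₁, h₂⟩ := mgf_sum_mul_sq ha ht
    have hsm : Measurable fun z : Fin n → ℝ => Real.exp (t * ∑ i, a i * z i ^ 2) := by fun_prop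
    rw [← hlaw k] at h₁ h₂
    rw [integral_map (hcoord k).aemeasurable hsm.aestronglyMeasurable] at h₂
    exact ⟨h₁.comp_measurable (hcoord k), h₂⟩
  have hsum : ∀ {t : ℝ}, |t| * T ≤ 1 / 4 →
      Integrable (fun b => Real.exp (t * (∑ k ∈ Finset.range s, Q k) b)) ν ∧
        mgf (∑ k ∈ Finset.range s, Q k) ν t ≤ Real.exp (s * (t * T + 4 * (t * T) ^ 2)) := by
    intro t ht
    refine ⟨hind.integrable_exp_mul_sum hmeas fun k _ => (hmgf ht k).1, ?_⟩
    rw [hind.mgf_sum hmeas]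
    calc ∏ k ∈ Finset.range s, mgf (Q k) ν t
        ≤ ∏ k ∈ Finset.range s, Real.exp (t * T + 4 * (t * T) ^ 2) :=
          Finset.prod_le_prod (fun k _ => mgf_nonneg) fun k _ => (hmgf ht k).2
      _ = _ := by rw [Finset.prod_const, Finset.card_range, ← Real.exp_nat_mul]
  have hup : ν.real {b | (1 + ε) * (s * T) ≤ (∑ k ∈ Finset.range s, Q k) b}
      ≤ Real.exp (-(s * ε ^ 2 / 16)) := by
    -- With `τ = tT`, the exponent is `s (4τ² - ετ)`. It is minimal at `τ = ε/8`, with value `-s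
    -- ε²/16`; the lower tail uses `-t`.
    have ht : |ε / (8 * T)| * T ≤ 1 / 4 := by
      rw [abs_of_pos (by positivity)]
      field_simp
      linarith
    obtain ⟨h₁, h₂⟩ := hsum ht
    refine (measure_ge_le_exp_mul_mgf _ (by positivity) h₁).trans
      ((mul_le_mul_of_nonneg_left h₂ (Real.exp_pos _).le).trans_eq ?_)
    rw [← Real.exp_add]
    congr 1
    field_simp
    ring
  have hlow : ν.real {b | (∑ k ∈ Finset.range s, Q k) b ≤ (1 - ε) * (s * T)}
      ≤ Real.exp (-(s * ε ^ 2 / 16)) := by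
    have ht : |-(ε / (8 * T))| * T ≤ 1 / 4 := by
      rw [abs_neg, abs_of_pos (by positivity)]
      field_simp
      linarith
    obtain ⟨h₁, h₂⟩ := hsum ht
    refine (measure_le_le_exp_mul_mgf _ (by rw [neg_nonpos]; positivity) h₁).trans
      ((mul_le_mul_of_nonneg_left h₂ (Real.exp_pos _).le).trans_eq ?_)
    rw [← Real.exp_add]
    congr 1
    field_simp
    ring
  have hsub : {b | ¬ |∑ k ∈ Finset.range s, Q k b - s * T| ≤ ε * (s * T)}
      ⊆ {b | (1 + ε) * (s * T) ≤ (∑ k ∈ Finset.range s, Q k) b}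
        ∪ {b | (∑ k ∈ Finset.range s, Q k) b ≤ (1 - ε) * (s * T)} := by
    intro b hb
    simp only [Set.mem_ofPred_eq, Set.mem_union, Finset.sum_apply] at hb ⊢
    rw [abs_le, not_and_or, not_le, not_le] at hb
    rcases hb with hb | hb
    · right; linarith
    · left; linarith
  refine (measureReal_mono hsub).trans ((measureReal_union_le _ _).trans ?_)
  linarith

end

section

variable {n : ℕ}

/-! ### Random signs -/

theorem signOf_sq (b : Bool) : signOf b ^ 2 = 1 := by
  cases b <;> simp [signOf]

/-- Pairing the two values of the first sign cancels the cross term. -/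
theorem sum_sign_dotProduct_sq (v : Fin n → ℝ) :
    ∑ c : Fin n → Bool, (∑ i, signOf (c i) * v i) ^ 2 = 2 ^ n * ∑ i, v i ^ 2 := by
  induction n with
  | zero => simp
  | succ n ih =>
    rw [← (Fin.consEquiv fun _ => Bool).sum_comp, Fintype.sum_prod_type, Fintype.sum_bool,
      ← Finset.sum_add_distrib]
    have h : ∀ c : Fin n → Bool,
        (∑ i, signOf ((Fin.consEquiv fun _ => Bool) (true, c) i) * v i) ^ 2
          + (∑ i, signOf ((Fin.consEquiv fun _ => Bool) (false, c) i) * v i) ^ 2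
        = 2 * (∑ i, signOf (c i) * v i.succ) ^ 2 + 2 * v 0 ^ 2 := by
      intro c
      simp only [Fin.sum_univ_succ, Fin.consEquiv_apply, Fin.cons_zero, Fin.cons_succ, signOf,
        if_true, Bool.false_eq_true, if_false]
      ring
    simp_rw [h]
    rw [Finset.sum_add_distrib, ← Finset.mul_sum, ih, Fin.sum_univ_succ]
    simp
    ring

/-- The same pairing cancels the odd powers of `v 0`; the mixed term is controlled by the exact
second moment. -/
theorem sum_sign_dotProduct_pow_four_le (v : Fin n → ℝ) :
    ∑ c : Fin n → Bool, (∑ i, signOf (c i) * v i) ^ 4 ≤ 3 * (2 ^ n * (∑ i, v i ^ 2) ^ 2) := by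
  induction n with
  | zero => simp
  | succ n ih =>
    rw [← (Fin.consEquiv fun _ => Bool).sum_comp, Fintype.sum_prod_type, Fintype.sum_bool,
      ← Finset.sum_add_distrib]
    have h : ∀ c : Fin n → Bool,
        (∑ i, signOf ((Fin.consEquiv fun _ => Bool) (true, c) i) * v i) ^ 4
          + (∑ i, signOf ((Fin.consEquiv fun _ => Bool) (false, c) i) * v i) ^ 4
        = 2 * (∑ i, signOf (c i) * v i.succ) ^ 4
          + 12 * v 0 ^ 2 * (∑ i, signOf (c i) * v i.succ) ^ 2 + 2 * v 0 ^ 4 := by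
      intro c
      simp only [Fin.sum_univ_succ, Fin.consEquiv_apply, Fin.cons_zero, Fin.cons_succ, signOf,
        if_true, Bool.false_eq_true, if_false]
      ring
    simp_rw [h]
    rw [Finset.sum_add_distrib, Finset.sum_add_distrib, ← Finset.mul_sum, ← Finset.mul_sum,
      sum_sign_dotProduct_sq, Fin.sum_univ_succ]
    have ih' := ih fun i => v i.succ
    simp only [Finset.sum_const, Finset.card_univ, Fintype.card_fun, Fintype.card_bool,
      Fintype.card_fin, nsmul_eq_mul, Nat.cast_pow, Nat.cast_ofNat]
    have hp : (0 : ℝ) ≤ 2 ^ n * v 0 ^ 4 := by positivity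
    rw [pow_succ (2 : ℝ) n]
    nlinarith

/-- A sign vector is correlated with a given unit vector with probability at least `3/16`. -/
theorem card_sign_dotProduct_sq_lt_le (v : Fin n → ℝ) (hv : ∑ i, v i ^ 2 = 1) :
    ((Finset.univ.filter fun c : Fin n → Bool =>
      (∑ i, signOf (c i) * v i) ^ 2 < 1 / 4).card : ℝ) ≤ 13 / 16 * 2 ^ n := by
  have h₂ := sum_sign_dotProduct_sq v
  have h₄ := sum_sign_dotProduct_pow_four_le v
  rw [hv] at h₂ h₄
  rw [Finset.card_filter]
  push_cast
  -- With `y = Z²`, the majorant is `1/8 + (y - 4)²/16`: positive everywhere and at least `1` for `y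
  -- < 1/4`. Its mean is at most `9/8 - 1/2 + 3/16 = 13/16`.
  calc ∑ c : Fin n → Bool, (if (∑ i, signOf (c i) * v i) ^ 2 < 1 / 4 then (1 : ℝ) else 0)
      ≤ ∑ c : Fin n → Bool, (9 / 8 - 1 / 2 * (∑ i, signOf (c i) * v i) ^ 2
          + 1 / 16 * (∑ i, signOf (c i) * v i) ^ 4) := by
        refine Finset.sum_le_sum fun c _ => ?_
        set Z := ∑ i, signOf (c i) * v i
        split_ifs with h
        · nlinarith [sq_nonneg (Z ^ 2)]
        · nlinarith [sq_nonneg (Z ^ 2 - 4)]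
    _ ≤ _ := by
        rw [Finset.sum_add_distrib, Finset.sum_sub_distrib, ← Finset.mul_sum, ← Finset.mul_sum, h₂]
        simp only [Finset.sum_const, Finset.card_univ, Fintype.card_fun, Fintype.card_bool,
          Fintype.card_fin, nsmul_eq_mul, Nat.cast_pow, Nat.cast_ofNat]
        linarith

/-- The law of a fair coin. -/
abbrev coin : Measure Bool := (PMF.uniformOfFintype Bool).toMeasure

theorem measureReal_pi_coin (A : Finset (Fin n → Bool)) :
    (Measure.pi fun _ : Fin n => coin).real (A : Set (Fin n → Bool)) = A.card / 2 ^ n := by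
  have h : ∀ c : Fin n → Bool, (Measure.pi fun _ : Fin n => coin).real {c} = (1 / 2) ^ n := by
    intro c
    rw [measureReal_def, Measure.pi_singleton]
    simp
  rw [← sum_measureReal_singleton]
  simp_rw [h]
  rw [Finset.sum_const, nsmul_eq_mul, one_div, inv_pow, div_eq_mul_inv]

theorem measureReal_forall_sign_dotProduct_sq_lt_le (v : Fin n → ℝ) (hv : ∑ i, v i ^ 2 = 1)
    (q : ℕ) :
    (Measure.infinitePi fun _ : ℕ × Fin n => coin).real
      {a | ∀ j < q, (∑ i, signOf (a (j, i)) * v i) ^ 2 < 1 / 4} ≤ (13 / 16) ^ q := by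
  set A : Finset (Fin n → Bool) := Finset.univ.filter fun c : Fin n → Bool =>
      (∑ i, signOf (c i) * v i) ^ 2 < 1 / 4
  have hset : {a : ℕ × Fin n → Bool | ∀ j < q, (∑ i, signOf (a (j, i)) * v i) ^ 2 < 1 / 4}
      = ⋂ j ∈ Finset.range q, (fun (a : ℕ × Fin n → Bool) i => a (j, i)) ⁻¹'
        (A : Set (Fin n → Bool)) := by
    ext a
    simp [A]
  have hA : ∀ j, (Measure.infinitePi fun _ : ℕ × Fin n => coin)
      ((fun (a : ℕ × Fin n → Bool) i => a (j, i)) ⁻¹' (A : Set (Fin n → Bool)))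
      = (Measure.pi fun _ : Fin n => coin) (A : Set (Fin n → Bool)) := by
    intro j
    rw [← map_row_infinitePi coin j, Measure.map_apply (by fun_prop) (Finset.measurableSet A)]
  rw [hset, measureReal_def, (iIndepFun_row_infinitePi (n := n) coin).measure_inter_preimage_eq_mul
    (Finset.range q) (fun _ _ => Finset.measurableSet A)]
  simp_rw [hA]
  rw [Finset.prod_const, Finset.card_range, ENNReal.toReal_pow, ← measureReal_def,
    measureReal_pi_coin]
  refine pow_le_pow_left₀ (by positivity) ?_ q
  rw [div_le_iff₀ (by positivity)]
  exact card_sign_dotProduct_sq_lt_le v hv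

/-- The constant `4.82` is a rounding up of `1 / ln (16/13)`. -/
theorem pow_powerReps_le {δ : ℝ} (hδ : 0 < δ) : (13 / 16 : ℝ) ^ powerReps δ ≤ δ := by
  have hlog : 1 ≤ 4.82 * Real.log (16 / 13) := by
    have h : (100 / 482 : ℝ) ≤ Real.log (16 / 13) := by
      rw [Real.le_log_iff_exp_le (by norm_num)]
      refine (Real.exp_bound' (by norm_num) (by norm_num) (n := 4) (by norm_num)).trans ?_
      norm_num [Finset.sum_range_succ, Nat.factorial]
    linarith
  by_cases h₁ : 1 ≤ δ
  · exact (pow_le_one₀ (by norm_num) (by norm_num)).trans h₁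
  have hL : 0 ≤ Real.log (1 / δ) := Real.log_nonneg (by rw [le_div_iff₀ hδ]; linarith)
  have hq : 4.82 * Real.log (1 / δ) ≤ powerReps δ := Nat.le_ceil _
  have h16 : 0 ≤ Real.log (16 / 13) := Real.log_nonneg (by norm_num)
  rw [← Real.log_le_log_iff (by positivity) hδ, Real.log_pow,
    show (13 / 16 : ℝ) = (16 / 13)⁻¹ by norm_num, Real.log_inv]
  rw [one_div, Real.log_inv] at hq hL
  nlinarith

/-! ### The power method -/

variable {R : Matrix (Fin n) (Fin n) ℝ} (hR : R.IsHermitian)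

theorem rayleigh_pow_mulVec (t : ℕ) (x : Fin n → ℝ) :
    rayleigh R ((R ^ t) *ᵥ x)
      = (∑ i, hR.eigenvalues i ^ (2 * t) * hR.eigenvalues i * eigenCoord hR x i ^ 2)
        / ∑ i, hR.eigenvalues i ^ (2 * t) * eigenCoord hR x i ^ 2 := by
  have h : ∀ i, eigenCoord hR ((R ^ t) *ᵥ x) i = hR.eigenvalues i ^ t * eigenCoord hR x i := by
    intro i
    have := eigenCoord_aeval_mulVec hR (Polynomial.X ^ t) x i
    simpa using this
  rw [rayleigh, dotProduct_eq_sum_eigenCoord hR, dotProduct_eq_sum_eigenCoord hR]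
  congr 1
  · refine Finset.sum_congr rfl fun i _ => ?_
    rw [eigenCoord_mulVec, h, pow_mul']
    ring
  · refine Finset.sum_congr rfl fun i _ => ?_
    rw [h, pow_mul']
    ring

theorem rayleigh_nonneg (hP : R.PosSemidef) (x : Fin n → ℝ) : 0 ≤ rayleigh R x := by
  refine div_nonneg ?_ ?_
  · simpa using hP.dotProduct_mulVec_nonneg x
  · exact Finset.sum_nonneg fun i _ => mul_self_nonneg _

theorem sum_eigenCoord_sq_sign (c : Fin n → Bool) :
    ∑ i, eigenCoord hR (fun i => signOf (c i)) i ^ 2 = n := by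
  have h := dotProduct_eq_sum_eigenCoord hR (fun i => signOf (c i)) (fun i => signOf (c i))
  simp only [← sq, dotProduct, signOf_sq] at h
  rw [← h]
  simp

theorem sum_pow_mul_eigenCoord_sq_pos {ℓ : ℝ} (hℓ : 0 < ℓ)
    (hmin : ∀ i, ℓ ≤ hR.eigenvalues i) (hn : 0 < n) (t : ℕ) (c : Fin n → Bool) :
    0 < ∑ i, hR.eigenvalues i ^ (2 * t) * eigenCoord hR (fun i => signOf (c i)) i ^ 2 := by
  have h : ℓ ^ (2 * t) * n
      ≤ ∑ i, hR.eigenvalues i ^ (2 * t) * eigenCoord hR (fun i => signOf (c i)) i ^ 2 := by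
    rw [← sum_eigenCoord_sq_sign hR c, Finset.mul_sum]
    exact Finset.sum_le_sum fun i _ =>
      mul_le_mul_of_nonneg_right (pow_le_pow_left₀ hℓ.le (hmin i) _) (sq_nonneg _)
  have : (0 : ℝ) < n := by exact_mod_cast hn
  exact lt_of_lt_of_le (by positivity) h

/-- The quotient is a weighted mean of eigenvalues. No luck with the signs is needed, as the running
time is claimed for every outcome. -/
theorem le_rayleigh_pow_mulVec {ℓ : ℝ} (hℓ : 0 < ℓ)
    (hmin : ∀ i, ℓ ≤ hR.eigenvalues i) (hn : 0 < n) (t : ℕ) (c : Fin n → Bool) :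
    ℓ ≤ rayleigh R ((R ^ t) *ᵥ fun i => signOf (c i)) := by
  rw [rayleigh_pow_mulVec hR, le_div_iff₀ (sum_pow_mul_eigenCoord_sq_pos hR hℓ hmin hn t c),
    Finset.mul_sum]
  refine Finset.sum_le_sum fun i _ => ?_
  have h : 0 ≤ hR.eigenvalues i := hℓ.le.trans (hmin i)
  rw [← mul_assoc, mul_comm ℓ]
  gcongr
  exact hmin i

/-- One repetition of the power method bounds, up to a factor of `6`, the eigenvalue of every
eigenvector with which the initial sign vector is correlated. -/
theorem eigenvalue_le_six_mul_rayleigh {ℓ : ℝ} (hℓ : 0 < ℓ)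
    (hmin : ∀ i, ℓ ≤ hR.eigenvalues i) (hn : 0 < n) (t : ℕ)
    (ht : Real.log (Real.sqrt (4 * n)) ≤ t) (c : Fin n → Bool) {i₀ : Fin n}
    (hc : 1 / 4 ≤ eigenCoord hR (fun i => signOf (c i)) i₀ ^ 2) :
    hR.eigenvalues i₀ ≤ 6 * rayleigh R ((R ^ t) *ᵥ fun i => signOf (c i)) := by
  have hn' : (0 : ℝ) < n := by exact_mod_cast hn
  set p := hR.eigenvalues i₀
  have hp : 0 < p := hℓ.trans_le (hmin i₀)
  -- The choice of `t` gives `4n ≤ e^{2t}`, and `e ≤ 6`.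
  have hpow : (4 * n : ℝ) ≤ 6 ^ (2 * t) := by
    have h₁ : Real.sqrt (4 * n) ≤ Real.exp t :=
      (Real.log_le_iff_le_exp (by positivity)).1 ht
    have h₂ : Real.exp t ≤ 6 ^ t := by
      rw [← Real.exp_one_pow]
      exact pow_le_pow_left₀ (Real.exp_pos _).le (by linarith [Real.exp_one_lt_d9]) t
    rw [pow_mul', ← Real.sqrt_le_left (by positivity)]
    exact h₁.trans h₂
  set C := fun i => eigenCoord hR (fun i => signOf (c i)) i ^ 2 with hC
  have hC₀ : ∀ i, 0 ≤ C i := fun i => sq_nonneg _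
  have hCn : ∑ i, C i = n := sum_eigenCoord_sq_sign hR c
  -- Only eigenvalues below `p/6` contribute negatively, and then by at most `(p/6)^{2t} p ≤
  -- p^{2t+1}/(4n)` per unit of weight.
  have hterm : ∀ i, -(p ^ (2 * t) * p / (4 * n)) * C i
      ≤ hR.eigenvalues i ^ (2 * t) * (6 * hR.eigenvalues i - p) * C i := by
    intro i
    refine mul_le_mul_of_nonneg_right ?_ (hC₀ i)
    have hi : 0 < hR.eigenvalues i := hℓ.trans_le (hmin i)
    rcases le_total p (6 * hR.eigenvalues i) with h | h
    · have h₁ : 0 ≤ hR.eigenvalues i ^ (2 * t) * (6 * hR.eigenvalues i - p) :=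
        mul_nonneg (by positivity) (by linarith)
      have h₂ : 0 ≤ p ^ (2 * t) * p / (4 * n) := by positivity
      linarith
    · have h₁ : hR.eigenvalues i ^ (2 * t) * (p - 6 * hR.eigenvalues i)
          ≤ (p / 6) ^ (2 * t) * p := by
        refine mul_le_mul (pow_le_pow_left₀ hi.le (by linarith) _) (by linarith) (by linarith)
          (by positivity)
      have h₂ : (p / 6) ^ (2 * t) * p ≤ p ^ (2 * t) * p / (4 * n) := by
        rw [div_pow, div_mul_eq_mul_div]
        exact div_le_div_of_nonneg_left (by positivity) (by positivity) hpow
      linarith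
  have hrest : -(p ^ (2 * t) * p / (4 * n)) * (n - C i₀)
      ≤ ∑ i ∈ Finset.univ.erase i₀,
        hR.eigenvalues i ^ (2 * t) * (6 * hR.eigenvalues i - p) * C i := by
    have h : ∑ i ∈ Finset.univ.erase i₀, C i = n - C i₀ := by
      rw [Finset.sum_erase_eq_sub (Finset.mem_univ i₀), hCn]
    rw [← h, Finset.mul_sum]
    exact Finset.sum_le_sum fun i _ => hterm i
  -- The weights sum to `n`, so the loss is at most `p^{2t+1}/4`, while `i₀` alone gains `5 C i₀
  -- p^{2t+1} ≥ (5/4) p^{2t+1}`.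
  have htotal : 0 ≤ ∑ i, hR.eigenvalues i ^ (2 * t) * (6 * hR.eigenvalues i - p) * C i := by
    rw [← Finset.add_sum_erase _ _ (Finset.mem_univ i₀)]
    have h₁ : p ^ (2 * t) * (6 * p - p) * C i₀ = 5 * C i₀ * (p ^ (2 * t) * p) := by ring
    have h₂ : p ^ (2 * t) * p / (4 * n) * (n - C i₀) ≤ 1 / 4 * (p ^ (2 * t) * p) := by
      have : p ^ (2 * t) * p / (4 * n) * n = 1 / 4 * (p ^ (2 * t) * p) := by field_simp
      have : 0 ≤ p ^ (2 * t) * p / (4 * n) * C i₀ := mul_nonneg (by positivity) (hC₀ _)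
      linarith
    have h₃ : 5 / 4 * (p ^ (2 * t) * p) ≤ 5 * C i₀ * (p ^ (2 * t) * p) := by
      have : 5 / 4 ≤ 5 * C i₀ := by
        have : 1 / 4 ≤ C i₀ := hc
        linarith
      gcongr
    have h₄ : 0 < p ^ (2 * t) * p := by positivity
    linarith
  rw [rayleigh_pow_mulVec hR, mul_div_assoc',
    le_div_iff₀ (sum_pow_mul_eigenCoord_sq_pos hR hℓ hmin hn t c)]
  have hsplit : ∑ i, hR.eigenvalues i ^ (2 * t) * (6 * hR.eigenvalues i - p) * C i
      = 6 * ∑ i, hR.eigenvalues i ^ (2 * t) * hR.eigenvalues i * C i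
        - p * ∑ i, hR.eigenvalues i ^ (2 * t) * C i := by
    rw [Finset.mul_sum, Finset.mul_sum, ← Finset.sum_sub_distrib]
    exact Finset.sum_congr rfl fun i _ => by ring
  linarith

end

section

variable {n : ℕ} {R : Matrix (Fin n) (Fin n) ℝ}

/-! ### Eigenvalues of a density matrix -/

theorem sum_eigenvalues_eq_one (hR : IsDensityMatrix R) :
    ∑ i, hR.posSemidef.isHermitian.eigenvalues i = 1 := by
  have h := hR.posSemidef.isHermitian.trace_eq_sum_eigenvalues
  rw [hR.trace_eq_one] at h
  simpa using h.symm

theorem eigenvalue_le_one_sub (hR : IsDensityMatrix R) {ℓ : ℝ} (hℓ : 0 < ℓ) (hn : 2 ≤ n)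
    (hmin : ∀ i, ℓ ≤ hR.posSemidef.isHermitian.eigenvalues i) (i : Fin n) :
    hR.posSemidef.isHermitian.eigenvalues i ≤ 1 - ℓ := by
  have : Nontrivial (Fin n) := Fin.nontrivial_iff_two_le.2 hn
  obtain ⟨j, hj⟩ := exists_ne i
  have h := sum_eigenvalues_eq_one hR
  rw [← Finset.add_sum_erase _ _ (Finset.mem_univ i)] at h
  have h₁ : hR.posSemidef.isHermitian.eigenvalues j
      ≤ ∑ k ∈ Finset.univ.erase i, hR.posSemidef.isHermitian.eigenvalues k :=
    Finset.single_le_sum (fun k _ => hℓ.le.trans (hmin k))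
      (Finset.mem_erase.2 ⟨hj, Finset.mem_univ j⟩)
  linarith [hmin j]

theorem le_half_of_le_eigenvalues (hR : IsDensityMatrix R) {ℓ : ℝ} (hℓ : 0 < ℓ) (hn : 2 ≤ n)
    (hmin : ∀ i, ℓ ≤ hR.posSemidef.isHermitian.eigenvalues i) : ℓ ≤ 1 / 2 := by
  have h := eigenvalue_le_one_sub hR hℓ hn hmin ⟨0, by omega⟩
  linarith [hmin ⟨0, by omega⟩]

theorem log_one_div_one_sub_pos {ℓ : ℝ} (hℓ : 0 < ℓ) (hℓ₂ : ℓ ≤ 1 / 2) :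
    0 < Real.log (1 / (1 - ℓ)) :=
  Real.log_pos (by rw [lt_div_iff₀ (by linarith)]; linarith)

theorem log_one_div_one_sub_le_one {ℓ : ℝ} (hℓ₂ : ℓ ≤ 1 / 2) :
    Real.log (1 / (1 - ℓ)) ≤ 1 := by
  have h₁ : (0 : ℝ) < 1 - ℓ := by linarith
  have h₂ : 1 / (1 - ℓ) ≤ 2 := by
    rw [div_le_iff₀ h₁]
    linarith
  linarith [Real.log_le_sub_one_of_pos (show 0 < 1 / (1 - ℓ) by positivity)]

/-- Both factors of `p · ln (1/p)` are bounded below separately. This floor converts the uniform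
error of the approximant into a relative one. -/
theorem le_neg_mul_log {ℓ p : ℝ} (hℓ : 0 < ℓ) (h₁ : ℓ ≤ p) (h₂ : p ≤ 1 - ℓ) :
    ℓ * Real.log (1 / (1 - ℓ)) ≤ -(p * Real.log p) := by
  have hp : 0 < p := hℓ.trans_le h₁
  rw [one_div, Real.log_inv, ← mul_neg]
  have h₃ : Real.log p ≤ Real.log (1 - ℓ) := Real.log_le_log hp h₂
  have h₄ : Real.log (1 - ℓ) ≤ 0 := Real.log_nonpos (by linarith) (by linarith)
  exact mul_le_mul h₁ (by linarith) (by linarith) hp.le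

/-- Relative accuracy of the Chebyshev approximant on the spectrum. -/
theorem abs_chebApprox_chebDegree_le {ℓ ε u p : ℝ} (hℓ : 0 < ℓ) (hℓ₂ : ℓ ≤ 1 / 2) (hε : 0 < ε)
    (h₁ : ℓ ≤ p) (h₂ : p ≤ 1 - ℓ) (hu : p ≤ u) :
    |(chebApprox u (chebDegree ℓ ε u)).eval p - p * Real.log p| ≤ ε * -(p * Real.log p) := by
  have hp : 0 < p := hℓ.trans_le h₁
  have hu₀ : 0 < u := hp.trans_le hu
  have hL := log_one_div_one_sub_pos hℓ hℓ₂
  set L := Real.log (1 / (1 - ℓ)) with hLdef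
  set m := chebDegree ℓ ε u with hmdef
  have hq : 0 < u / (2 * ε * ℓ * L) := by positivity
  have hm : Real.sqrt (u / (2 * ε * ℓ * L)) ≤ m := Nat.le_ceil _
  have hm₁ : 1 ≤ m := Nat.ceil_pos.2 (Real.sqrt_pos.2 hq)
  have hm₀ : (0 : ℝ) < m := by exact_mod_cast hm₁
  have hm₂ : u / (2 * ε * ℓ * L) ≤ (m : ℝ) ^ 2 := (Real.sqrt_le_left hm₀.le).1 hm
  refine (abs_chebApprox_sub_le hu₀ hp hu hm₁).trans ?_
  -- `m² ≥ u/(2εℓL)` already gives `u/(2m²) ≤ εℓL`.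
  have h₃ : u / (2 * m * (m + 1)) ≤ ε * (ℓ * L) := by
    rw [div_le_iff₀ (by positivity)] at hm₂ ⊢
    nlinarith [mul_pos hε (mul_pos hℓ hL), mul_pos (mul_pos hε (mul_pos hℓ hL)) hm₀]
  exact h₃.trans (mul_le_mul_of_nonneg_left (le_neg_mul_log hℓ h₁ h₂) hε.le)

/-! ### Failure probability of the Gaussian stage -/

theorem le_numSamples_mul_sq {ε : ℝ} (hε : 0 < ε) (δ : ℝ) :
    20 * Real.log (2 / δ) ≤ numSamples ε δ * ε ^ 2 := by
  rw [← div_le_iff₀ (by positivity)]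
  exact Nat.le_ceil _

theorem two_mul_exp_numSamples_le {ε δ : ℝ} (hε : 0 < ε) (hδ : 0 < δ) (hδ₁ : δ ≤ 1 / 2) :
    2 * Real.exp (-(numSamples ε δ * ε ^ 2 / 16)) ≤ δ := by
  have h := le_numSamples_mul_sq hε δ
  have hlog : 0 ≤ Real.log (2 / δ) := Real.log_nonneg (by rw [le_div_iff₀ hδ]; linarith)
  have h₁ : Real.exp (-(numSamples ε δ * ε ^ 2 / 16)) ≤ Real.exp (-Real.log (2 / δ)) :=
    Real.exp_le_exp.2 (by linarith)
  rw [Real.exp_neg (Real.log _), Real.exp_log (by positivity), inv_div] at h₁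
  linarith

theorem numSamples_pos {ε δ : ℝ} (hε : 0 < ε) (hδ : 0 < δ) (hδ₁ : δ ≤ 1 / 2) :
    0 < numSamples ε δ := by
  have : 0 < Real.log (2 / δ) := Real.log_pos (by rw [lt_div_iff₀ hδ]; linarith)
  exact Nat.ceil_pos.2 (by positivity)

/-- For a fixed upper bound `u` on the spectrum, the trace estimate fails with probability at
most `δ`. -/
theorem measureReal_traceEstimate_le (hR : IsDensityMatrix R) {ℓ ε δ u : ℝ} (hn : 2 ≤ n)
    (hℓ : 0 < ℓ) (hmin : ∀ i, ℓ ≤ hR.posSemidef.isHermitian.eigenvalues i)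
    (hε : 0 < ε) (hε₁ : ε < 1) (hδ : 0 < δ) (hδ₁ : δ ≤ 1 / 2)
    (hu : ∀ i, hR.posSemidef.isHermitian.eigenvalues i ≤ u) (a : ℕ × Fin n → Bool) :
    (Measure.infinitePi fun _ : ℕ × Fin n => gaussianReal 0 1).real
      {b | ¬ |traceEstimate R u (chebDegree ℓ ε u) (numSamples ε δ) (a, b)
          - vonNeumannEntropy hR.posSemidef.isHermitian|
        ≤ 3 * ε * vonNeumannEntropy hR.posSemidef.isHermitian} ≤ δ := by
  set hH := hR.posSemidef.isHermitian
  set s := numSamples ε δ with hs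
  set f := chebApprox u (chebDegree ℓ ε u) with hf
  have hℓ₂ := le_half_of_le_eigenvalues hR hℓ hn hmin
  have hs₀ : (0 : ℝ) < s := by exact_mod_cast numSamples_pos hε hδ hδ₁
  have hL := log_one_div_one_sub_pos hℓ hℓ₂
  have happ : ∀ i, |f.eval (hH.eigenvalues i) - hH.eigenvalues i * Real.log (hH.eigenvalues i)|
      ≤ ε * -(hH.eigenvalues i * Real.log (hH.eigenvalues i)) := fun i =>
    abs_chebApprox_chebDegree_le hℓ hℓ₂ hε (hmin i) (eigenvalue_le_one_sub hR hℓ hn hmin i) (hu i)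
  have hpos : ∀ i, 0 < -(hH.eigenvalues i * Real.log (hH.eigenvalues i)) := fun i =>
    (mul_pos hℓ hL).trans_le (le_neg_mul_log hℓ (hmin i) (eigenvalue_le_one_sub hR hℓ hn hmin i))
  have hent : vonNeumannEntropy hH
      = ∑ i, -(hH.eigenvalues i * Real.log (hH.eigenvalues i)) := by
    rw [vonNeumannEntropy, Finset.sum_neg_distrib]
  -- Relative error `ε < 1` keeps `-f` at least `(1 - ε)` times a positive number, so the quadratic
  -- form has the nonnegative weights that the concentration bound requires.
  have ha : ∀ i, 0 < -f.eval (hH.eigenvalues i) := by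
    intro i
    have h₁ := (abs_le.1 (happ i)).2
    nlinarith [hpos i]
  have hn₀ : (Finset.univ : Finset (Fin n)).Nonempty := ⟨⟨0, by omega⟩, Finset.mem_univ _⟩
  have hT : 0 < ∑ i, -f.eval (hH.eigenvalues i) := Finset.sum_pos (fun i _ => ha i) hn₀
  have hTH : |∑ i, -f.eval (hH.eigenvalues i) - vonNeumannEntropy hH|
      ≤ ε * vonNeumannEntropy hH := by
    rw [hent, ← Finset.sum_sub_distrib, Finset.mul_sum]
    refine (Finset.abs_sum_le_sum_abs _ _).trans (Finset.sum_le_sum fun i _ => ?_)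
    rw [neg_sub_neg, abs_sub_comm]
    exact happ i
  have hH₀ : 0 < vonNeumannEntropy hH := hent ▸ Finset.sum_pos (fun i _ => hpos i) hn₀
  refine le_trans (measureReal_mono ?_)
    ((measureReal_gaussian_quadratic_le hH (fun i => (ha i).le) hT hε hε₁ s).trans
      (two_mul_exp_numSamples_le hε hδ hδ₁))
  intro b hb
  simp only [Set.mem_ofPred_eq] at hb ⊢
  contrapose! hb
  set T := ∑ i, -f.eval (hH.eigenvalues i)
  set W := ∑ k ∈ Finset.range s, ∑ i, -f.eval (hH.eigenvalues i) *
    eigenCoord hH (fun j => b (k, j)) i ^ 2 with hW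
  have hest : traceEstimate R u (chebDegree ℓ ε u) s (a, b) = W / s := by
    have h : ∀ k, gaussVec (a, b) k ⬝ᵥ (Polynomial.aeval R f *ᵥ gaussVec (a, b) k)
        = -∑ i, -f.eval (hH.eigenvalues i) * eigenCoord hH (fun j => b (k, j)) i ^ 2 := by
      intro k
      rw [dotProduct_aeval_mulVec hH, ← Finset.sum_neg_distrib]
      exact Finset.sum_congr rfl fun i _ => by rw [neg_mul, neg_neg]; rfl
    rw [traceEstimate, ← hf]
    simp_rw [h]
    rw [Finset.sum_neg_distrib, ← hW]
    ring
  have hdev : |W / s - T| ≤ ε * T := by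
    have : W / s - T = (W - s * T) / s := by field_simp
    rw [this, abs_div, abs_of_pos hs₀, div_le_iff₀ hs₀]
    linarith
  rw [hest]
  -- From `T ≤ (1 + ε) H`; hence sampling error `εT ≤ 2εH` plus approximation error `εH` make `3εH`.
  have h₁ : T ≤ 2 * vonNeumannEntropy hH := by
    have := (abs_le.1 hTH).2
    nlinarith
  calc |W / s - vonNeumannEntropy hH|
      ≤ |W / s - T| + |T - vonNeumannEntropy hH| := abs_sub_le _ _ _
    _ ≤ ε * T + ε * vonNeumannEntropy hH := add_le_add hdev hTH
    _ ≤ 3 * ε * vonNeumannEntropy hH := by nlinarith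

/-! ### Failure probability of the power method -/

theorem powerReps_pos {δ : ℝ} (hδ : 0 < δ) (hδ₁ : δ ≤ 1 / 2) : 0 < powerReps δ := by
  have : 0 < Real.log (1 / δ) := Real.log_pos (by rw [lt_div_iff₀ hδ]; linarith)
  exact Nat.ceil_pos.2 (by positivity)

theorem rayleigh_le_powerEstimate (q t : ℕ) (ω : Tape n) {j : ℕ} (hj : j < q) :
    rayleigh R ((R ^ t) *ᵥ signVec ω j) ≤ powerEstimate R q t ω :=
  le_ciSup (f := fun j : Fin q => rayleigh R ((R ^ t) *ᵥ signVec ω j))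
    (Set.Finite.bddAbove (Set.finite_range _)) ⟨j, hj⟩

theorem le_upperEstimate (hR : IsDensityMatrix R) {ℓ δ : ℝ} (hn : 2 ≤ n) (hℓ : 0 < ℓ)
    (hmin : ∀ i, ℓ ≤ hR.posSemidef.isHermitian.eigenvalues i) (hδ : 0 < δ) (hδ₁ : δ ≤ 1 / 2)
    (ω : Tape n) : ℓ ≤ upperEstimate R δ ω := by
  have h₁ := le_half_of_le_eigenvalues hR hℓ hn hmin
  have h₂ := le_rayleigh_pow_mulVec hR.posSemidef.isHermitian hℓ hmin (by omega) (powerIters n)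
    fun i => ω.1 (0, i)
  have h₃ := rayleigh_le_powerEstimate (R := R) (powerReps δ) (powerIters n) ω
    (powerReps_pos hδ hδ₁)
  refine le_min (by linarith) ?_
  have h₄ : ℓ ≤ powerEstimate R (powerReps δ) (powerIters n) ω := h₂.trans h₃
  linarith

/-- Failure requires every sign vector to be poorly correlated with one fixed top eigenvector.
Capping at `1` is harmless, since no eigenvalue exceeds `1`. -/
theorem measureReal_eigenvalues_le_upperEstimate (hR : IsDensityMatrix R) {ℓ δ : ℝ} (hn : 2 ≤ n)
    (hℓ : 0 < ℓ) (hmin : ∀ i, ℓ ≤ hR.posSemidef.isHermitian.eigenvalues i) (hδ : 0 < δ)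
    (b : ℕ × Fin n → ℝ) :
    (Measure.infinitePi fun _ : ℕ × Fin n => coin).real
      {a | ¬ ∀ i, hR.posSemidef.isHermitian.eigenvalues i ≤ upperEstimate R δ (a, b)} ≤ δ := by
  set hH := hR.posSemidef.isHermitian
  have : Nonempty (Fin n) := ⟨⟨0, by omega⟩⟩
  obtain ⟨i₀, hi₀⟩ := Finite.exists_max hH.eigenvalues
  have hv : ∑ i, (hH.eigenvectorBasis i₀).ofLp i ^ 2 = 1 := by
    have h := hH.eigenvectorBasis.orthonormal.1 i₀
    rw [EuclideanSpace.norm_eq, Real.sqrt_eq_one] at h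
    simpa using h
  refine le_trans (measureReal_mono ?_)
    ((measureReal_forall_sign_dotProduct_sq_lt_le _ hv (powerReps δ)).trans (pow_powerReps_le hδ))
  intro a ha
  simp only [Set.mem_ofPred_eq] at ha ⊢
  contrapose! ha
  obtain ⟨j, hj, hc⟩ := ha
  intro i
  refine (hi₀ i).trans (le_min ?_ ?_)
  · exact (eigenvalue_le_one_sub hR hℓ hn hmin i₀).trans (by linarith)
  · have h := eigenvalue_le_six_mul_rayleigh hH hℓ hmin (by omega) (powerIters n)
      (Nat.le_ceil _) (fun i => a (j, i)) (i₀ := i₀) (by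
        rw [eigenCoord_eq_dotProduct, dotProduct_comm]
        exact hc)
    have h' := rayleigh_le_powerEstimate (R := R) (powerReps δ) (powerIters n) (a, b) hj
    have h'' : hH.eigenvalues i₀
        ≤ 6 * rayleigh R ((R ^ powerIters n) *ᵥ signVec (a, b) j) := h
    linarith

/-! ### Both stages together -/

/-- A union bound over the values of the first component of a random pair. -/
theorem measure_prod_le_of_forall_slice {α β κ : Type*} [MeasurableSpace α] [MeasurableSpace β]
    [MeasurableSpace κ] [Fintype κ] [MeasurableSingletonClass κ] (μ : Measure α)
    [IsProbabilityMeasure μ] (ν : Measure β) [SFinite ν] {f : α → κ} (hf : Measurable f)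
    (B : κ → Set β) {c : ENNReal} (hB : ∀ k, ν (B k) ≤ c) :
    (μ.prod ν) {ω | ω.2 ∈ B (f ω.1)} ≤ c := by
  have hsub : {ω : α × β | ω.2 ∈ B (f ω.1)} ⊆ ⋃ k ∈ Finset.univ, (f ⁻¹' {k}) ×ˢ B k := by
    intro ω hω
    simp only [Set.mem_iUnion]
    exact ⟨f ω.1, Finset.mem_univ _, rfl, hω⟩
  calc (μ.prod ν) {ω | ω.2 ∈ B (f ω.1)}
      ≤ ∑ k, (μ.prod ν) ((f ⁻¹' {k}) ×ˢ B k) :=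
        (measure_mono hsub).trans (measure_biUnion_finset_le _ _)
    _ ≤ ∑ k, μ (f ⁻¹' {k}) * c :=
        Finset.sum_le_sum fun k _ => by
          rw [Measure.prod_prod]
          gcongr
          exact hB k
    _ = c := by
        rw [← Finset.sum_mul, sum_measure_preimage_singleton _
          (fun k _ => hf (measurableSet_singleton k)), Finset.coe_univ, Set.preimage_univ,
          measure_univ, one_mul]

/-- `u` as a function of the signs that the power method draws. -/
def upperEstimateOfSigns (R : Matrix (Fin n) (Fin n) ℝ) (δ : ℝ)
    (c : Fin (powerReps δ) × Fin n → Bool) : ℝ :=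
  min 1 (6 * ⨆ j : Fin (powerReps δ),
    rayleigh R ((R ^ powerIters n) *ᵥ fun i => signOf (c (j, i))))

theorem tapeMeasure_entropyEstimate_ge (hR : IsDensityMatrix R) {ℓ ε δ : ℝ} (hn : 2 ≤ n)
    (hℓ : 0 < ℓ) (hmin : ∀ i, ℓ ≤ hR.posSemidef.isHermitian.eigenvalues i)
    (hε : 0 < ε) (hε₁ : ε < 1) (hδ : 0 < δ) (hδ₁ : δ ≤ 1 / 2) :
    ENNReal.ofReal (1 - 2 * δ) ≤ tapeMeasure n
      {ω | |entropyEstimate R ℓ ε δ ω - vonNeumannEntropy hR.posSemidef.isHermitian|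
        ≤ 3 * ε * vonNeumannEntropy hR.posSemidef.isHermitian} := by
  set hH := hR.posSemidef.isHermitian
  set S := {ω : Tape n | |entropyEstimate R ℓ ε δ ω - vonNeumannEntropy hH|
        ≤ 3 * ε * vonNeumannEntropy hH} with hS
  set μ := Measure.infinitePi fun _ : ℕ × Fin n => coin with hμ
  set ν := Measure.infinitePi fun _ : ℕ × Fin n => gaussianReal 0 1 with hν
  have htape : tapeMeasure n = μ.prod ν := rfl
  set F : Set (ℕ × Fin n → Bool) :=
    {a | ¬ ∀ i, hH.eigenvalues i ≤ upperEstimate R δ (a, 0)} with hF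
  -- `c` is the finite block of signs that determines `u`. The trace estimate at a given `u` ignores
  -- the coins, so an arbitrary constant coin sequence is supplied.
  set B : (Fin (powerReps δ) × Fin n → Bool) → Set (ℕ × Fin n → ℝ) := fun c =>
    {b | (∀ i, hH.eigenvalues i ≤ upperEstimateOfSigns R δ c) ∧
      ¬ |traceEstimate R (upperEstimateOfSigns R δ c)
          (chebDegree ℓ ε (upperEstimateOfSigns R δ c)) (numSamples ε δ) (fun _ => true, b)
          - vonNeumannEntropy hH| ≤ 3 * ε * vonNeumannEntropy hH} with hB
  have hFle : μ F ≤ ENNReal.ofReal δ := by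
    rw [← ofReal_measureReal]
    exact ENNReal.ofReal_le_ofReal
      (measureReal_eigenvalues_le_upperEstimate hR hn hℓ hmin hδ 0)
  have hBle : ∀ c, ν (B c) ≤ ENNReal.ofReal δ := by
    intro c
    by_cases hc : ∀ i, hH.eigenvalues i ≤ upperEstimateOfSigns R δ c
    · rw [← ofReal_measureReal]
      refine ENNReal.ofReal_le_ofReal (le_trans (measureReal_mono ?_)
        (measureReal_traceEstimate_le hR hn hℓ hmin hε hε₁ hδ hδ₁ hc fun _ => true))
      exact fun b hb => hb.2
    · have : B c = ∅ := Set.eq_empty_of_forall_notMem fun b hb => hc hb.1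
      rw [this, measure_empty]
      exact zero_le
  have hsub : Sᶜ ⊆ F ×ˢ Set.univ ∪ {ω | ω.2 ∈ B (fun p => ω.1 (p.1, p.2))} := by
    intro ω hω
    by_cases h : ∀ i, hH.eigenvalues i ≤ upperEstimate R δ ω
    · exact Or.inr ⟨h, hω⟩
    · exact Or.inl ⟨h, Set.mem_univ _⟩
  have hcompl : (μ.prod ν) Sᶜ ≤ ENNReal.ofReal (2 * δ) := by
    refine (measure_mono hsub).trans ((measure_union_le _ _).trans ?_)
    rw [two_mul, ENNReal.ofReal_add hδ.le hδ.le]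
    refine add_le_add ?_ ?_
    · rw [Measure.prod_prod, measure_univ, mul_one]
      exact hFle
    · exact measure_prod_le_of_forall_slice μ ν
        (f := fun a (p : Fin (powerReps δ) × Fin n) => a (p.1, p.2)) (by fun_prop) B hBle
  rw [htape, ENNReal.ofReal_sub _ (by positivity), ENNReal.ofReal_one, tsub_le_iff_right]
  -- Subadditivity bounds the success event from below without establishing its measurability.
  calc (1 : ENNReal) = (μ.prod ν) Set.univ := measure_univ.symm
    _ ≤ (μ.prod ν) S + (μ.prod ν) Sᶜ := by
        rw [← Set.union_compl_self S]
        exact measure_union_le _ _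
    _ ≤ _ := add_le_add le_rfl hcompl

/-! ### Running time -/

/-- A positive definite matrix has a positive diagonal. -/
theorem le_nnz (hR : IsDensityMatrix R) {ℓ : ℝ} (hℓ : 0 < ℓ)
    (hmin : ∀ i, ℓ ≤ hR.posSemidef.isHermitian.eigenvalues i) : n ≤ nnz R := by
  have hpd : R.PosDef := hR.posSemidef.isHermitian.posDef_iff_eigenvalues_pos.2
    fun i => hℓ.trans_le (hmin i)
  have h : (Finset.univ.image fun i : Fin n => (i, i))
      ⊆ Finset.univ.filter fun p : Fin n × Fin n => R p.1 p.2 ≠ 0 := by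
    intro p hp
    obtain ⟨i, _, rfl⟩ := Finset.mem_image.1 hp
    exact Finset.mem_filter.2 ⟨Finset.mem_univ _, hpd.diag_pos.ne'⟩
  have := Finset.card_le_card h
  rwa [Finset.card_image_of_injective _ (fun i j hij => (Prod.ext_iff.1 hij).1),
    Finset.card_univ, Fintype.card_fin] at this

theorem log_le_log_one_div {δ : ℝ} (hδ : 0 < δ) (hδ₁ : δ ≤ 1 / 2) :
    Real.log 2 ≤ Real.log (1 / δ) :=
  Real.log_le_log two_pos (by rw [le_div_iff₀ hδ]; linarith)

/-- The `+1` from rounding is absorbed by `ln (1/δ) ≥ ln 2`; the bounds on `t` and `s` work alike.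
-/
theorem powerReps_le {δ : ℝ} (hδ : 0 < δ) (hδ₁ : δ ≤ 1 / 2) :
    (powerReps δ : ℝ) ≤ 7 * Real.log (1 / δ) := by
  have h₁ := log_le_log_one_div hδ hδ₁
  have h₂ := Real.log_two_gt_d9
  have h₃ := Nat.ceil_lt_add_one (show 0 ≤ 4.82 * Real.log (1 / δ) by linarith)
  rw [powerReps]
  linarith

theorem powerIters_le (hn : 2 ≤ n) : (powerIters n : ℝ) ≤ 3 * Real.log n := by
  have hn' : (2 : ℝ) ≤ n := by exact_mod_cast hn
  have h₁ : Real.log 2 ≤ Real.log n := Real.log_le_log two_pos hn'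
  have h₂ := Real.log_two_gt_d9
  have h₃ : Real.log (Real.sqrt (4 * n)) = Real.log 2 + Real.log n / 2 := by
    rw [Real.log_sqrt (by positivity), Real.log_mul (by norm_num) (by positivity),
      show (4 : ℝ) = 2 ^ 2 by norm_num, Real.log_pow]
    push_cast
    ring
  have h₄ := Nat.ceil_lt_add_one (show 0 ≤ Real.log (Real.sqrt (4 * n)) by linarith)
  rw [powerIters]
  linarith

theorem numSamples_le {ε δ : ℝ} (hε : 0 < ε) (hε₁ : ε < 1) (hδ : 0 < δ) (hδ₁ : δ ≤ 1 / 2) :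
    (numSamples ε δ : ℝ) ≤ 42 * Real.log (1 / δ) / ε ^ 2 := by
  have h₁ := log_le_log_one_div hδ hδ₁
  have h₂ := Real.log_two_gt_d9
  have h₃ : Real.log (2 / δ) = Real.log 2 + Real.log (1 / δ) := by
    rw [← Real.log_mul two_ne_zero (by positivity), mul_one_div]
  have h₄ := Nat.ceil_lt_add_one (show 0 ≤ 20 * Real.log (2 / δ) / ε ^ 2 by
    rw [h₃]
    have : 0 ≤ Real.log 2 + Real.log (1 / δ) := by linarith
    positivity)
  refine h₄.le.trans ?_
  rw [div_add_one (by positivity), h₃]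
  gcongr
  have : ε ^ 2 ≤ 1 := pow_le_one₀ hε.le hε₁.le
  linarith

/-- Rounding and the extra loop pass each cost `1`. Both are absorbed since `u ≥ ℓ` and `ln
(1/(1-ℓ)) ≤ 1` make the main term at least `1`. -/
theorem chebDegree_add_one_le {ℓ ε u : ℝ} (hℓ : 0 < ℓ) (hℓ₂ : ℓ ≤ 1 / 2) (hε : 0 < ε)
    (hε₁ : ε < 1) (hu : ℓ ≤ u) :
    (chebDegree ℓ ε u : ℝ) + 1
      ≤ 3 * Real.sqrt (u / (ℓ * Real.log (1 / (1 - ℓ)))) / Real.sqrt ε := by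
  have hL := log_one_div_one_sub_pos hℓ hℓ₂
  have hL₁ := log_one_div_one_sub_le_one hℓ₂
  rw [chebDegree]
  set L := Real.log (1 / (1 - ℓ))
  have hK : 1 ≤ Real.sqrt (u / (ℓ * L)) := by
    rw [Real.one_le_sqrt, le_div_iff₀ (by positivity)]
    nlinarith
  have hsε : 0 < Real.sqrt ε := Real.sqrt_pos.2 hε
  have hsε₁ : Real.sqrt ε ≤ 1 := Real.sqrt_le_one.2 hε₁.le
  have h₁ : Real.sqrt (u / (2 * ε * ℓ * L)) ≤ Real.sqrt (u / (ℓ * L)) / Real.sqrt ε := by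
    rw [← Real.sqrt_div' _ hε.le]
    refine Real.sqrt_le_sqrt ?_
    rw [div_div]
    have hu₀ : 0 < u := hℓ.trans_le hu
    refine div_le_div_of_nonneg_left hu₀.le (by positivity) ?_
    nlinarith [mul_pos (mul_pos hℓ hL) hε]
  have h₂ : 1 ≤ Real.sqrt (u / (ℓ * L)) / Real.sqrt ε := by
    rw [le_div_iff₀ hsε]
    linarith
  have h₃ := Nat.ceil_lt_add_one (Real.sqrt_nonneg (u / (2 * ε * ℓ * L)))
  rw [mul_div_assoc]
  linarith

theorem steps_entropyProg_le_real (hR : IsDensityMatrix R) {ℓ ε δ : ℝ} (hn : 2 ≤ n)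
    (hℓ : 0 < ℓ) (hmin : ∀ i, ℓ ≤ hR.posSemidef.isHermitian.eigenvalues i)
    (hε : 0 < ε) (hε₁ : ε < 1) (hδ : 0 < δ) (hδ₁ : δ ≤ 1 / 2) (ω : Tape n) :
    ((entropyProg (sparseRows R) ℓ ε δ ω).steps : ℝ)
      ≤ 6000 * ((Real.sqrt (upperEstimate R δ ω / (ℓ * Real.log (1 / (1 - ℓ))))
          * (1 / ε ^ (5 / 2 : ℝ)) + Real.log n) * Real.log (1 / δ) * nnz R) := by
  have hℓ₂ := le_half_of_le_eigenvalues hR hℓ hn hmin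
  have hnnz := le_nnz hR hℓ hmin
  have hsteps : ((entropyProg (sparseRows R) ℓ ε δ ω).steps : ℝ)
      ≤ powerReps δ * ((15 + 5 * powerIters n) * nnz R)
        + numSamples ε δ * ((chebDegree ℓ ε (upperEstimate R δ ω) + 1) * (43 * nnz R)) + 29 := by
    exact_mod_cast steps_entropyProg_le R (rayleigh_nonneg hR.posSemidef) hnnz (by omega) ℓ ε δ ω
  have hq := powerReps_le hδ hδ₁
  have ht := powerIters_le hn
  have hs := numSamples_le hε hε₁ hδ hδ₁
  have hm := chebDegree_add_one_le hℓ hℓ₂ hε hε₁ (le_upperEstimate hR hn hℓ hmin hδ hδ₁ ω)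
  have hlog₂ := Real.log_two_gt_d9
  have hD : (0.69 : ℝ) ≤ Real.log (1 / δ) := by linarith [log_le_log_one_div hδ hδ₁]
  have hN : (0.69 : ℝ) ≤ Real.log n := by
    have := Real.log_le_log two_pos (show (2 : ℝ) ≤ n by exact_mod_cast hn)
    linarith
  have hZ : (2 : ℝ) ≤ nnz R := by exact_mod_cast hn.trans hnnz
  have hpow : ε ^ (5 / 2 : ℝ) = ε ^ 2 * Real.sqrt ε := by
    rw [Real.sqrt_eq_rpow, ← Real.rpow_natCast, ← Real.rpow_add hε]
    norm_num
  set K := Real.sqrt (upperEstimate R δ ω / (ℓ * Real.log (1 / (1 - ℓ))))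
  set D := Real.log (1 / δ)
  set N := Real.log n
  set Z : ℝ := (nnz R : ℝ)
  have hK : 0 ≤ K := Real.sqrt_nonneg _
  have hsε : 0 < Real.sqrt ε := Real.sqrt_pos.2 hε
  have h₁ : (powerReps δ : ℝ) * ((15 + 5 * powerIters n) * Z) ≤ 7 * D * (37 * N * Z) := by
    gcongr
    linarith
  have h₂ : (numSamples ε δ : ℝ) * ((chebDegree ℓ ε (upperEstimate R δ ω) + 1) * (43 * Z))
      ≤ 42 * D / ε ^ 2 * (3 * K / Real.sqrt ε * (43 * Z)) := by
    gcongr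
  -- `ε²` from the sample count and `√ε` from the degree combine to `ε^{5/2}`; `5418 = 42 · 3 · 43`.
  have h₃ : 42 * D / ε ^ 2 * (3 * K / Real.sqrt ε * (43 * Z))
      = 5418 * (K * (1 / ε ^ (5 / 2 : ℝ)) * D * Z) := by
    rw [hpow]
    field_simp
    ring
  have hDN : 0.47 ≤ N * D := by nlinarith
  -- This lower bound lets the additive `29` disappear into the `ln n` term.
  have hDNZ : 0.94 ≤ N * D * Z := by nlinarith
  have hKEDZ : 0 ≤ K * (1 / ε ^ (5 / 2 : ℝ)) * D * Z := by positivity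
  have h₄ : 7 * D * (37 * N * Z) = 259 * (N * D * Z) := by ring
  have h₅ : 6000 * ((K * (1 / ε ^ (5 / 2 : ℝ)) + N) * D * Z)
      = 6000 * (K * (1 / ε ^ (5 / 2 : ℝ)) * D * Z) + 6000 * (N * D * Z) := by ring
  rw [h₅]
  linarith

end

end EntropyEstimation

end

/-! ### Accuracy, correctness of the program and running time combined -/

theorem mainTheorem2 :
    ∃ C : ℝ, 0 < C ∧
      ∀ (n : ℕ) (R : Matrix (Fin n) (Fin n) ℝ) (hR : EntropyEstimation.IsDensityMatrix R)
        (ℓ ε δ : ℝ),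
        2 ≤ n →
        0 < ℓ → (∀ i, ℓ ≤ hR.posSemidef.isHermitian.eigenvalues i) →
        0 < ε → ε < 1 →
        0 < δ → δ ≤ 1 / 2 →
        ENNReal.ofReal (1 - 2 * δ) ≤
            EntropyEstimation.tapeMeasure n
              {ω | |EntropyEstimation.entropyEstimate R ℓ ε δ ω
                    - EntropyEstimation.vonNeumannEntropy hR.posSemidef.isHermitian|
                  ≤ 3 * ε * EntropyEstimation.vonNeumannEntropy hR.posSemidef.isHermitian} ∧
          ∀ ω : EntropyEstimation.Tape n,
            (EntropyEstimation.entropyProg (EntropyEstimation.sparseRows R) ℓ ε δ ω).val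
                = EntropyEstimation.entropyEstimate R ℓ ε δ ω ∧
            ((EntropyEstimation.entropyProg (EntropyEstimation.sparseRows R) ℓ ε δ ω).steps : ℝ)
                ≤ C * ((Real.sqrt (EntropyEstimation.upperEstimate R δ ω
                            / (ℓ * Real.log (1 / (1 - ℓ)))) * (1 / ε ^ (5 / 2 : ℝ))
                          + Real.log n)
                        * Real.log (1 / δ) * EntropyEstimation.nnz R) := by
  refine ⟨6000, by norm_num, fun n R hR ℓ ε δ hn hℓ hmin hε hε₁ hδ hδ₁ => ⟨?_, fun ω => ⟨?_, ?_⟩⟩⟩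
  · exact EntropyEstimation.tapeMeasure_entropyEstimate_ge hR hn hℓ hmin hε hε₁ hδ hδ₁
  · exact EntropyEstimation.val_entropyProg R
      (EntropyEstimation.rayleigh_nonneg hR.posSemidef) ℓ ε δ ω
  · exact EntropyEstimation.steps_entropyProg_le_real hR hn hℓ hmin hε hε₁ hδ hδ₁ ω
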